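/- Conventions. Let $(\Omega,\Sigma,\xi)$ be a measure space and $L^0(\xi)$ the space of $\xi$-a.e. classes of $\Sigma$-measurable real functions. A Banach function space (B.f.s.) $Z(\xi)$ is a Banach space contained in $L^0(\xi)$ such that $f\in Z(\xi)$, $g\in L^0(\xi)$, $|g|\le|f|$ $\xi$-a.e. imply $g\in Z(\xi)$ and $\|g\|\le\|f\|$. For $r>0$, $Z(\xi)^r=\{f:|f|^r\in Z(\xi)\}$ with the quasi-norm $\|f\|_{Z(\xi)^r}=\||f|^r\|_{Z(\xi)}^{1/r}$. The space $Z(\xi)$ is $p$-convex (with constant $C$) if $\|(\sum_{j}|f_j|^p)^{1/p}\|\le C(\sum_j\|f_j\|^p)^{1/p}$ for all finite families in it. A linear operator $T$ from a space $X$ of this kind into a quasi-normed space is $q$-concave if for some $C>0$, $(\sum_j\|Tf_j\|^q)^{1/q}\le C\|(\sum_j|f_j|^q)^{1/q}\|_X$ for all finite families in $X$; $Z(\xi)$ is $q$-concave if its identity map is. A vector measure $m:\mathcal R\to E$ is a countably additive function on a $\delta$-ring $\mathcal R$ of subsets of $\Omega$ with values in a Banach space $E$, and $\mathcal R^{loc}=\{A: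 A\cap B\in\mathcal R\ \forall B\in\mathcal R\}$. $L^1(m)$ is the space of $m$-a.e. classes of $\mathcal R^{loc}$-measurable functions $f$ such that $f\in L^1(|x^*m|)$ for all $x^*\in E^*$ and for every $A\in\mathcal R^{loc}$ there is $\int_A f\,dm\in E$ with $x^*(\int_A f\,dm)=\int_A f\,dx^*m$ for all $x^*\in E^*$; its norm is $\|f\|_m=\sup_{\|x^*\|\le1}\int|f|\,d|x^*m|$. Further, $L^p(m)=L^1(m)^p$ is the $p$-power, and $I_m:L^1(m)\to E$ is $I_m(f)=\int_\Omega f\,dm$. Proposition. Let $p,q\in(0,\infty)$ and let $Z(\xi)$ be a $q$-concave B.f.s. which is also $p$-convex in the case $p>1$. Then: (1) There is a norm on $Z(\xi)^{1/p}$, equivalent to its quasi-norm, for which it is a B.f.s.; this norm can be taken equal to the quasi-norm of $Z(\xi)^{1/p}$ if $p\le1$ or if $Z(\xi)$ is $p$-convex with constant $1$. (2) Such a norm can be chosen so that the following holds. Let $E$ be the Banach space so obtained. Then $\Sigma_{Z(\xi)}=\{A\in\Sigma:\chi_A\in Z(\xi)\}$ is a $\delta$-ring, $m:\Sigma_{Z(\xi)}\to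 E$, $m(A)=\chi_A$, is a vector measure, and $Z(\xi)$ coincides with $L^p(m)$: every set of $\Sigma$ is in $(\Sigma_{Z(\xi)})^{loc}$, every $\xi$-null set is $m$-null, and the map sending the $\xi$-a.e. class of a function to its $m$-a.e. class is a bijection from $Z(\xi)$ onto $L^p(m)$ for which the norm of $Z(\xi)$ and the quasi-norm of $L^p(m)$ are equivalent (equal if $p\le1$ or $Z(\xi)$ is $p$-convex with constant $1$). Moreover $I_m:L^1(m)\to E$ is linear and $\frac qp$-concave. (3) If $\chi_\Omega\in Z(\xi)$, then $\Sigma_{Z(\xi)}=\Sigma$, so that $m$ is defined on a $\sigma$-algebra. -/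

import Mathlib

open MeasureTheory Filter Topology Set
open scoped ENNReal

universe u

noncomputable section

/-! ### Function spaces of classes of measurable functions -/

/-- The space `L⁰(μ)` of classes of real measurable functions, where functions which are equal
`μ`-a.e. are identified. -/
abbrev L0 {Ω : Type*} {mΩ : MeasurableSpace Ω} (μ : Measure Ω) : Type _ :=
  Ω →ₘ[μ] ℝ

/-- The data of a normed or quasi-normed space of (classes of) real measurable functions: the set
of its elements inside `L⁰(μ)`, and the value of the quasi-norm on these elements. The value of
`qnorm` outside `carrier` has no meaning and is never used. -/
structure FnSpace {Ω : Type*} {mΩ : MeasurableSpace Ω} (μ : Measure Ω) where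
  carrier : Set (L0 μ)
  qnorm : (L0 μ) → ℝ

/-- The class of `|f|^p`. -/
def absPow {Ω : Type*} {mΩ : MeasurableSpace Ω} {μ : Measure Ω} (p : ℝ) (f : L0 μ) :
    L0 μ :=
  AEEqFun.mk (fun x => |f x| ^ p) (by
    have := f.aemeasurable
    exact AEMeasurable.aestronglyMeasurable (by fun_prop))

/-- The class of `(∑ j, |f_j|^q)^(1/q)`. -/
def lqSum {Ω : Type*} {mΩ : MeasurableSpace Ω} {μ : Measure Ω} (q : ℝ) {n : ℕ}
    (f : Fin n → L0 μ) : L0 μ :=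
  AEEqFun.mk (fun x => (∑ j, |f j x| ^ q) ^ (1 / q)) (by
    have := fun j => (f j).aemeasurable
    exact AEMeasurable.aestronglyMeasurable (by fun_prop))

namespace FnSpace

variable {Ω : Type*} {mΩ : MeasurableSpace Ω} {μ : Measure Ω}

/-- Banach function space: a Banach space contained in `L⁰(μ)` which is an ideal of `L⁰(μ)` and
whose norm is monotone. -/
structure IsBanachFunctionSpace (X : FnSpace μ) : Prop where
  zero_mem : 0 ∈ X.carrier
  add_mem : ∀ f ∈ X.carrier, ∀ g ∈ X.carrier, f + g ∈ X.carrier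
  smul_mem : ∀ (c : ℝ), ∀ f ∈ X.carrier, c • f ∈ X.carrier
  norm_nonneg : ∀ f ∈ X.carrier, 0 ≤ X.qnorm f
  norm_eq_zero_iff : ∀ f ∈ X.carrier, X.qnorm f = 0 ↔ f = 0
  norm_smul : ∀ (c : ℝ), ∀ f ∈ X.carrier, X.qnorm (c • f) = |c| * X.qnorm f
  norm_add_le : ∀ f ∈ X.carrier, ∀ g ∈ X.carrier, X.qnorm (f + g) ≤ X.qnorm f + X.qnorm g
  complete : ∀ u : ℕ → L0 μ, (∀ n, u n ∈ X.carrier) →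
    (∀ ε > 0, ∃ N, ∀ k ≥ N, ∀ n ≥ N, X.qnorm (u k - u n) < ε) →
    ∃ f ∈ X.carrier, Tendsto (fun n => X.qnorm (u n - f)) atTop (𝓝 0)
  ideal : ∀ f ∈ X.carrier, ∀ g : L0 μ, (∀ᵐ x ∂μ, |g x| ≤ |f x|) →
    g ∈ X.carrier ∧ X.qnorm g ≤ X.qnorm f

/-- The `p`-power `X^p = {f : |f|^p ∈ X}`, with `‖f‖ = ‖|f|^p‖_X^(1/p)`. -/
def power (X : FnSpace μ) (p : ℝ) : FnSpace μ where
  carrier := {f | absPow p f ∈ X.carrier}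
  qnorm f := X.qnorm (absPow p f) ^ (1 / p)

/-- `X` is `p`-convex, and `C` is an admissible constant in the inequality. -/
def IsConvexWith (X : FnSpace μ) (p C : ℝ) : Prop :=
  ∀ (n : ℕ) (f : Fin n → L0 μ), (∀ j, f j ∈ X.carrier) →
    X.qnorm (lqSum p f) ≤ C * (∑ j, X.qnorm (f j) ^ p) ^ (1 / p)

/-- `X` is `p`-convex. -/
def IsConvex (X : FnSpace μ) (p : ℝ) : Prop :=
  ∃ C > 0, X.IsConvexWith p C

/-- `T : X → F` is a linear operator which is `q`-concave, where `N` is the quasi-norm of `F`. -/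
def IsConcaveOperator {F : Type*} [AddCommGroup F] [Module ℝ F] (X : FnSpace μ) (N : F → ℝ)
    (T : (L0 μ) → F) (q : ℝ) : Prop :=
  (∀ f ∈ X.carrier, ∀ g ∈ X.carrier, T (f + g) = T f + T g) ∧
  (∀ (c : ℝ), ∀ f ∈ X.carrier, T (c • f) = c • T f) ∧
  ∃ C > 0, ∀ (n : ℕ) (f : Fin n → L0 μ), (∀ j, f j ∈ X.carrier) →
    (∑ j, N (T (f j)) ^ q) ^ (1 / q) ≤ C * X.qnorm (lqSum q f)

/-- `X` is `q`-concave: the identity map `X → X` is. -/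
def IsConcave (X : FnSpace μ) (q : ℝ) : Prop :=
  X.IsConcaveOperator X.qnorm id q

/-- The characteristic function of `A` belongs to `X`. -/
def HasIndicator (X : FnSpace μ) (A : Set Ω) : Prop :=
  ∃ f ∈ X.carrier, f =ᵐ[μ] A.indicator (fun _ => (1 : ℝ))

/-- `Σ_X`: the measurable sets whose characteristic function belongs to `X`. -/
def indicatorSets (X : FnSpace μ) : Set (Set Ω) :=
  {A | MeasurableSet A ∧ X.HasIndicator A}

end FnSpace

/-- A function representing a class. -/
def L0.rep {Ω : Type*} {mΩ : MeasurableSpace Ω} {μ : Measure Ω} (f : L0 μ) : Ω → ℝ := f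

theorem L0.stronglyMeasurable_rep {Ω : Type*} {mΩ : MeasurableSpace Ω} {μ : Measure Ω}
    (f : L0 μ) : StronglyMeasurable f.rep :=
  AEEqFun.stronglyMeasurable f

/-- The map `[i]`, sending the `μ`-a.e. class of a function to the `ν`-a.e. class of the same
function. Here `ν` may live on a larger σ-algebra. It does not depend on the chosen
representatives as soon as every `μ`-null set is `ν`-null. -/
def changeClass {Ω : Type*} {m₁ m₂ : MeasurableSpace Ω} (h : m₁ ≤ m₂)
    (μ : @Measure Ω m₁) (ν : @Measure Ω m₂) (f : L0 μ) : L0 ν :=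
  AEEqFun.mk (L0.rep f) ((L0.stronglyMeasurable_rep f).mono h).aestronglyMeasurable

/-- The two function spaces coincide up to equivalence of norms, the constants being `c` and `C`:
the map `[i]` which takes a class to the class of the same function is well defined, is a
bijection from `X` onto `Y`, and `c ‖f‖_X ≤ ‖f‖_Y ≤ C ‖f‖_X`. -/
def CoincideWith {Ω : Type*} {m₁ m₂ : MeasurableSpace Ω} {μ : @Measure Ω m₁} {ν : @Measure Ω m₂}
    (X : FnSpace μ) (Y : FnSpace ν) (c C : ℝ) : Prop :=
  ∃ h : m₁ ≤ m₂, (∀ s : Set Ω, μ s = 0 → ν s = 0) ∧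
    BijOn (changeClass h μ ν) X.carrier Y.carrier ∧
    ∀ f ∈ X.carrier, c * X.qnorm f ≤ Y.qnorm (changeClass h μ ν f) ∧
      Y.qnorm (changeClass h μ ν f) ≤ C * X.qnorm f

/-! ### Vector measures on δ-rings -/

/-- A `δ`-ring of subsets of `Ω`. -/
structure DeltaRing (Ω : Type*) where
  sets : Set (Set Ω)
  empty_mem : ∅ ∈ sets
  union_mem : ∀ A ∈ sets, ∀ B ∈ sets, A ∪ B ∈ sets
  diff_mem : ∀ A ∈ sets, ∀ B ∈ sets, A \ B ∈ sets
  iInter_mem : ∀ A : ℕ → Set Ω, (∀ n, A n ∈ sets) → ⋂ n, A n ∈ sets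

namespace DeltaRing

variable {Ω : Type*}

/-- The σ-algebra `R^loc` of the sets `A` with `A ∩ B ∈ R` for all `B ∈ R`. -/
@[reducible] def loc (R : DeltaRing Ω) : MeasurableSpace Ω where
  MeasurableSet' A := ∀ B ∈ R.sets, A ∩ B ∈ R.sets
  measurableSet_empty B _ := by simpa using R.empty_mem
  measurableSet_compl A hA B hB := by
    have : Aᶜ ∩ B = B \ (A ∩ B) := by ext; simp; tauto
    rw [this]
    exact R.diff_mem _ hB _ (hA B hB)
  measurableSet_iUnion A hA B hB := by
    have : (⋃ n, A n) ∩ B = B \ ⋂ n, (B \ (A n ∩ B)) := by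
      ext x
      simp only [mem_inter_iff, mem_iUnion, Set.mem_sdiff, mem_iInter, not_forall]
      constructor
      · rintro ⟨⟨n, hn⟩, hx⟩
        exact ⟨hx, n, fun h => h.2 ⟨hn, hx⟩⟩
      · rintro ⟨hx, n, hn⟩
        refine ⟨⟨n, ?_⟩, hx⟩
        by_contra hn'
        exact hn ⟨hx, fun h => hn' h.1⟩
    rw [this]
    exact R.diff_mem _ hB _ (R.iInter_mem _ fun n => R.diff_mem _ hB _ (hA n B hB))

end DeltaRing

/-- A vector measure `m : R → E` on the `δ`-ring `R`. It is stored as a function on all subsets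
of `Ω`; its values outside `R` have no meaning and are never used. -/
structure DeltaRingMeasure {Ω : Type*} (R : DeltaRing Ω) (E : Type*) [NormedAddCommGroup E] where
  toFun : Set Ω → E
  hasSum' : ∀ A : ℕ → Set Ω, (∀ n, A n ∈ R.sets) → Pairwise (fun i j => Disjoint (A i) (A j)) →
    (⋃ n, A n) ∈ R.sets → HasSum (fun n => toFun (A n)) (toFun (⋃ n, A n))

/-- An `R`-simple function `∑ j, a_j χ_{A_j}` with `A_j ∈ R`. -/
structure RSimple {Ω : Type*} (R : DeltaRing Ω) where
  n : ℕ
  coeff : Fin n → ℝ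
  set : Fin n → Set Ω
  set_mem : ∀ j, set j ∈ R.sets

/-- The value of an `R`-simple function at a point. -/
def RSimple.eval {Ω : Type*} {R : DeltaRing Ω} (φ : RSimple R) (x : Ω) : ℝ :=
  ∑ j, φ.coeff j * (φ.set j).indicator (fun _ => (1 : ℝ)) x

namespace DeltaRingMeasure

variable {Ω : Type*} {R : DeltaRing Ω} {E : Type*} [NormedAddCommGroup E]

/-- The finite disjoint sequences in `R ∩ 2^A`. -/
def IsPartialPartition (R : DeltaRing Ω) (A : Set Ω) (l : List (Set Ω)) : Prop :=
  l.Pairwise Disjoint ∧ ∀ B ∈ l, B ∈ R.sets ∧ B ⊆ A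

/-- The variation as a set function: `sup ∑ |λ(A_j)|` over the finite disjoint sequences `(A_j)`
in `R ∩ 2^A`. -/
def variationFun (ν : DeltaRingMeasure R ℝ) (A : Set Ω) : ℝ≥0∞ :=
  ⨆ (l : List (Set Ω)) (_ : IsPartialPartition R A l), (l.map fun B => ‖ν.toFun B‖ₑ).sum

theorem toFun_empty (m : DeltaRingMeasure R E) : m.toFun ∅ = 0 := by
  have h := m.hasSum' (fun _ => ∅) (fun _ => R.empty_mem) (fun _ _ _ => by simp)
    (by simpa using R.empty_mem)
  have h2 := h.summable.tendsto_atTop_zero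
  exact tendsto_nhds_unique tendsto_const_nhds h2

theorem le_variationFun (ν : DeltaRingMeasure R ℝ) {A : Set Ω} {l : List (Set Ω)}
    (hl : IsPartialPartition R A l) : (l.map fun B => ‖ν.toFun B‖ₑ).sum ≤ ν.variationFun A :=
  le_iSup₂ (f := fun (l : List (Set Ω)) (_ : IsPartialPartition R A l) =>
    (l.map fun B => ‖ν.toFun B‖ₑ).sum) l hl

theorem variationFun_empty (ν : DeltaRingMeasure R ℝ) : ν.variationFun ∅ = 0 := by
  refine le_antisymm (iSup₂_le fun l hl => ?_) bot_le
  refine le_of_eq (List.sum_eq_zero fun x hx => ?_)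
  obtain ⟨B, hB, rfl⟩ := List.mem_map.1 hx
  have : B = ∅ := subset_empty_iff.1 (hl.2 B hB).2
  simp [this, toFun_empty]

theorem variationFun_mono (ν : DeltaRingMeasure R ℝ) {A B : Set Ω} (h : A ⊆ B) :
    ν.variationFun A ≤ ν.variationFun B :=
  iSup₂_le fun _ hl => ν.le_variationFun
    ⟨hl.1, fun C hC => ⟨(hl.2 C hC).1, (hl.2 C hC).2.trans h⟩⟩

theorem variationFun_union_ge (ν : DeltaRingMeasure R ℝ) {A B : Set Ω} (h : Disjoint A B) :
    ν.variationFun A + ν.variationFun B ≤ ν.variationFun (A ∪ B) := by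
  have key : ∀ l, IsPartialPartition R A l → ∀ l', IsPartialPartition R B l' →
      (l.map fun B => ‖ν.toFun B‖ₑ).sum + (l'.map fun B => ‖ν.toFun B‖ₑ).sum
        ≤ ν.variationFun (A ∪ B) := by
    intro l hl l' hl'
    rw [← List.sum_append, ← List.map_append]
    refine ν.le_variationFun ⟨List.pairwise_append.2 ⟨hl.1, hl'.1, fun C hC D hD => ?_⟩, ?_⟩
    · exact h.mono (hl.2 C hC).2 (hl'.2 D hD).2
    · intro C hC
      rcases List.mem_append.1 hC with hC | hC
      · exact ⟨(hl.2 C hC).1, (hl.2 C hC).2.trans subset_union_left⟩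
      · exact ⟨(hl'.2 C hC).1, (hl'.2 C hC).2.trans subset_union_right⟩
  have nil : ∀ C : Set Ω, IsPartialPartition R C [] := fun C => ⟨List.Pairwise.nil, by simp⟩
  unfold variationFun
  exact ENNReal.biSup_add_biSup_le' ⟨[], nil A⟩ ⟨[], nil B⟩ key

theorem variationFun_iUnion (ν : DeltaRingMeasure R ℝ) (A : ℕ → Set Ω)
    (hA : ∀ n, MeasurableSet[R.loc] (A n)) (hd : Pairwise (Function.onFun Disjoint A)) :
    ν.variationFun (⋃ n, A n) = ∑' n, ν.variationFun (A n) := by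
  apply le_antisymm
  · refine iSup₂_le fun l hl => ?_
    have h1 : ∀ B ∈ l, ‖ν.toFun B‖ₑ ≤ ∑' n, ‖ν.toFun (A n ∩ B)‖ₑ := by
      intro B hB
      have hU : (⋃ n, A n ∩ B) = B := by
        rw [← iUnion_inter]
        exact inter_eq_right.2 (hl.2 B hB).2
      have hs := ν.hasSum' (fun n => A n ∩ B) (fun n => hA n B (hl.2 B hB).1)
        (fun i j hij => (hd hij).mono inter_subset_left inter_subset_left)
        (by rw [hU]; exact (hl.2 B hB).1)
      rw [hU] at hs
      rw [← hs.tsum_eq]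
      exact enorm_tsum_le_tsum_enorm
    have h2 : ∀ l' : List (Set Ω), (l'.map fun B => ∑' n, ‖ν.toFun (A n ∩ B)‖ₑ).sum
        = ∑' n, (l'.map fun B => ‖ν.toFun (A n ∩ B)‖ₑ).sum := by
      intro l'
      induction l' with
      | nil => simp
      | cons B l' ih => simp [ih, ENNReal.tsum_add]
    refine (List.sum_le_sum h1).trans ?_
    rw [h2]
    refine ENNReal.tsum_le_tsum fun n => ?_
    have h3 : IsPartialPartition R (A n) (l.map fun B => A n ∩ B) := by
      refine ⟨List.Pairwise.map _ (fun C D h => h.mono inter_subset_right inter_subset_right)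
        hl.1, ?_⟩
      intro C hC
      obtain ⟨B, hB, rfl⟩ := List.mem_map.1 hC
      exact ⟨hA n B (hl.2 B hB).1, inter_subset_left⟩
    simpa [List.map_map, Function.comp_def] using ν.le_variationFun h3
  · rw [ENNReal.tsum_eq_iSup_nat]
    refine iSup_le fun N => ?_
    have h4 : ∑ n ∈ Finset.range N, ν.variationFun (A n)
        ≤ ν.variationFun (⋃ n ∈ Finset.range N, A n) := by
      induction N with
      | zero => simp
      | succ N ih =>
        rw [Finset.sum_range_succ]
        refine (add_le_add_left ih _).trans ?_
        refine (ν.variationFun_union_ge ?_).trans (ν.variationFun_mono ?_)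
        · refine disjoint_iUnion₂_left.2 fun i hi => hd ?_
          exact (Finset.mem_range.1 hi).ne
        · rw [Finset.range_add_one, Finset.set_biUnion_insert, union_comm]
    exact h4.trans (ν.variationFun_mono (iUnion₂_subset_iUnion _ _))

/-- The variation `|λ| : R^loc → [0,∞]` of a real measure `λ` on `R`. -/
def variation (ν : DeltaRingMeasure R ℝ) : @Measure Ω R.loc :=
  @Measure.ofMeasurable Ω R.loc (fun A _ => ν.variationFun A) ν.variationFun_empty
    (fun A hA hd => ν.variationFun_iUnion A hA hd)

/-- The integral over `A` of an `R`-simple function with respect to a real measure. -/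
def simpleIntegral (ν : DeltaRingMeasure R ℝ) (φ : RSimple R) (A : Set Ω) : ℝ :=
  ∑ j, φ.coeff j * ν.toFun (φ.set j ∩ A)

/-- `r = ∫_A f dλ` for a real measure `λ` and `f ∈ L¹(λ)`: `r` is the limit of `∫_A φ_n dλ` for
a sequence of `R`-simple functions `φ_n` converging to `f` in `L¹(|λ|)`. -/
def HasRealIntegral (ν : DeltaRingMeasure R ℝ) (f : Ω → ℝ) (A : Set Ω) (r : ℝ) : Prop :=
  ∃ φ : ℕ → RSimple R,
    Tendsto (fun n => ∫⁻ x, ‖(φ n).eval x - f x‖ₑ ∂ν.variation) atTop (𝓝 0) ∧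
    Tendsto (fun n => ν.simpleIntegral (φ n) A) atTop (𝓝 r)

variable [NormedSpace ℝ E]

/-- The real measure `x* m`. -/
def dualComp (m : DeltaRingMeasure R E) (x' : E →L[ℝ] ℝ) : DeltaRingMeasure R ℝ where
  toFun A := x' (m.toFun A)
  hasSum' A hA hd hU := (m.hasSum' A hA hd hU).mapL x'

/-- A measure on `R^loc` which has the same null sets as the semivariation of `m`: the sum of the
measures `|x* m|` over all `x*`. Only its null sets matter: `L⁰(m)` is the space of its classes
of measurable functions. -/
def control (m : DeltaRingMeasure R E) : @Measure Ω R.loc :=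
  @Measure.sum Ω (E →L[ℝ] ℝ) R.loc fun x' => (m.dualComp x').variation

/-- `x = ∫_A f dm`, i.e. `x*(x) = ∫_A f dx*m` for every `x*`. -/
def HasIntegral (m : DeltaRingMeasure R E) (f : L0 m.control) (A : Set Ω) (x : E) : Prop :=
  ∀ x' : E →L[ℝ] ℝ, (m.dualComp x').HasRealIntegral f A (x' x)

/-- The space `L¹(m)` of the classes `f` which belong to `L¹(x* m)` for every `x*` and have an
integral over every set of `R^loc`, with the norm
`‖f‖ = sup {∫ |f| d|x* m| : ‖x*‖ ≤ 1}`. -/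
def L1 (m : DeltaRingMeasure R E) : FnSpace m.control where
  carrier := {f | (∀ x' : E →L[ℝ] ℝ, Integrable f (m.dualComp x').variation) ∧
    ∀ A, MeasurableSet[R.loc] A → ∃ x, m.HasIntegral f A x}
  qnorm f := (⨆ (x' : E →L[ℝ] ℝ) (_ : ‖x'‖ ≤ 1), ∫⁻ x, ‖f x‖ₑ ∂(m.dualComp x').variation).toReal

/-- The space `L^p(m)`, the `p`-power of `L¹(m)`. -/
def Lp (m : DeltaRingMeasure R E) (p : ℝ) : FnSpace m.control :=
  m.L1.power p

open Classical in
/-- The integration operator `I_m f = ∫_Ω f dm` on `L¹(m)`. -/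
def integrationOperator (m : DeltaRingMeasure R E) (f : L0 m.control) : E :=
  if h : ∃ x, m.HasIntegral f univ x then h.choose else 0

end DeltaRingMeasure

end

/-! Put r = 1/p. The quasi-norm of Z^r satisfies ‖g‖ ≤ D ∑ ‖f_j‖ whenever |g| ≤ ∑ |f_j|
(`HasSumEstimate`): for p ≤ 1 by convexity of t ↦ t^r, for p > 1 because this is p-convexity
rewritten; D = 1 in the isometric cases. Hence the infimum of ∑ ‖f_j‖ over such families is a
monotone norm lying between D⁻¹‖·‖ and ‖·‖. It turns Z^r into a B.f.s. Y
(`power_renorm_isBanachFunctionSpace`), which inherits q/p-concavity (`power_renorm_isConcave`).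

The core concerns any s-concave B.f.s. X, applied to X = Y and s = q/p. Concavity bounds the ℓ^s-sum
of the norms of disjoint pieces of one element, so X is order continuous (`tendsto_restrict`). This
makes m(A) = χ_A countably additive and simple functions dense. Then X = L¹(m) isometrically, and
I_m is the identity under this identification (`coincideWith_L1`). For the norms, |x*(f)| ≤ ∫ |f|
d|x*m| ≤ ‖x*‖‖f‖, and Hahn–Banach shows that the supremum over the unit ball is ‖f‖. For
surjectivity, a function g in L¹(m) is m-a.e. equal to its own integral over Ω. Concavity of I_m is
therefore concavity of Y, and taking p-powers gives L^p(m) = (Z^(1/p))^p = Z (`coincideWith_Lp`).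

The delicate point is that R^loc may be larger than Σ and that an m-null set need not be ξ-null. Two
facts repair this: elements of X vanish a.e. on m-null sets of Σ (`ae_eq_zero_of_forall_null`), and
an R^loc-measurable function becomes Σ-measurable once cut down to a countable union of sets of R
(`measurable_indicator_of_loc`). -/

open MeasureTheory Filter Topology Set
open scoped ENNReal

noncomputable section

/-! ### Banach function spaces as Banach spaces with a pointwise a.e. order -/

namespace FnSpace.IsBanachFunctionSpace

variable {Ω : Type*} {mΩ : MeasurableSpace Ω} {μ : Measure Ω} {X : FnSpace μ}

/-- A Banach function space as a subspace of `L⁰(μ)`. -/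
def submodule (hX : X.IsBanachFunctionSpace) : Submodule ℝ (L0 μ) where
  carrier := X.carrier
  add_mem' ha hb := hX.add_mem _ ha _ hb
  zero_mem' := hX.zero_mem
  smul_mem' c _ hf := hX.smul_mem c _ hf

/-- A Banach function space as a type, which is a Banach space. -/
def Space (hX : X.IsBanachFunctionSpace) : Type _ := hX.submodule

variable (hX : X.IsBanachFunctionSpace)

instance : AddCommGroup hX.Space := inferInstanceAs (AddCommGroup hX.submodule)

instance : Module ℝ hX.Space := inferInstanceAs (Module ℝ hX.submodule)

/-- The inclusion of a Banach function space into the space of classes of functions. -/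
def incl : hX.Space →ₗ[ℝ] L0 μ := hX.submodule.subtype

theorem incl_mem (e : hX.Space) : hX.incl e ∈ X.carrier := e.2

theorem incl_injective : Function.Injective hX.incl := Subtype.val_injective

theorem exists_incl_eq {f : L0 μ} (hf : f ∈ X.carrier) : ∃ e, hX.incl e = f := ⟨⟨f, hf⟩, rfl⟩

theorem range_incl : range hX.incl = X.carrier :=
  Subset.antisymm (range_subset_iff.2 hX.incl_mem) fun _ hf => hX.exists_incl_eq hf

instance : Norm hX.Space := ⟨fun e => X.qnorm (hX.incl e)⟩

theorem norm_eq (e : hX.Space) : ‖e‖ = X.qnorm (hX.incl e) := rfl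

theorem core : NormedSpace.Core ℝ hX.Space where
  norm_nonneg e := hX.norm_nonneg _ (hX.incl_mem e)
  norm_smul c e := by
    rw [norm_eq, map_smul, hX.norm_smul c _ (hX.incl_mem e), Real.norm_eq_abs, norm_eq]
  norm_triangle a b := by
    rw [norm_eq, map_add]
    exact hX.norm_add_le _ (hX.incl_mem a) _ (hX.incl_mem b)
  norm_eq_zero_iff e := by
    rw [norm_eq, hX.norm_eq_zero_iff _ (hX.incl_mem e), ← map_zero hX.incl]
    exact hX.incl_injective.eq_iff

instance : NormedAddCommGroup hX.Space := NormedAddCommGroup.ofCore hX.core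

instance : NormedSpace ℝ hX.Space := NormedSpace.ofCore hX.core

instance : CompleteSpace hX.Space := by
  refine Metric.complete_of_cauchySeq_tendsto fun v hv => ?_
  obtain ⟨f, hf, hlim⟩ := hX.complete (fun n => hX.incl (v n)) (fun n => hX.incl_mem _) (by
    intro ε hε
    obtain ⟨N, hN⟩ := Metric.cauchySeq_iff.1 hv ε hε
    refine ⟨N, fun k hk n hn => ?_⟩
    rw [← map_sub, ← norm_eq, ← dist_eq_norm]
    exact hN k hk n hn)
  obtain ⟨e, rfl⟩ := hX.exists_incl_eq hf
  refine ⟨e, tendsto_iff_norm_sub_tendsto_zero.2 ?_⟩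
  simpa only [norm_eq, map_sub] using hlim

theorem incl_add (a b : hX.Space) :
    ∀ᵐ x ∂μ, hX.incl (a + b) x = hX.incl a x + hX.incl b x := by
  rw [map_add]; exact AEEqFun.coeFn_add _ _

theorem incl_sub (a b : hX.Space) :
    ∀ᵐ x ∂μ, hX.incl (a - b) x = hX.incl a x - hX.incl b x := by
  rw [map_sub]; exact AEEqFun.coeFn_sub _ _

theorem incl_smul (c : ℝ) (a : hX.Space) :
    ∀ᵐ x ∂μ, hX.incl (c • a) x = c * hX.incl a x := by
  rw [map_smul]; exact AEEqFun.coeFn_smul _ _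

theorem incl_zero : ∀ᵐ x ∂μ, hX.incl 0 x = 0 := by
  rw [map_zero]; exact AEEqFun.coeFn_zero

theorem incl_sum {ι : Type*} (s : Finset ι) (a : ι → hX.Space) :
    ∀ᵐ x ∂μ, hX.incl (∑ i ∈ s, a i) x = ∑ i ∈ s, hX.incl (a i) x := by
  classical
  induction s using Finset.induction_on with
  | empty => simpa using hX.incl_zero
  | insert i s hi ih =>
    rw [Finset.sum_insert hi]
    filter_upwards [ih, hX.incl_add (a i) (∑ i ∈ s, a i)] with x h1 h2
    rw [h2, h1, Finset.sum_insert hi]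

variable {hX}

theorem ext_ae {a b : hX.Space} (h : ∀ᵐ x ∂μ, hX.incl a x = hX.incl b x) : a = b :=
  hX.incl_injective (AEEqFun.ext h)

theorem norm_le_of_ae {a b : hX.Space} (h : ∀ᵐ x ∂μ, |hX.incl a x| ≤ |hX.incl b x|) :
    ‖a‖ ≤ ‖b‖ :=
  (hX.ideal _ (hX.incl_mem b) _ h).2

/-- The ideal property for functions instead of classes; new elements of the space are mostly built
through it or its scaled version. -/
theorem exists_of_le {f : Ω → ℝ} (hf : AEStronglyMeasurable f μ) (b : hX.Space)
    (h : ∀ᵐ x ∂μ, |f x| ≤ |hX.incl b x|) : ∃ a, ∀ᵐ x ∂μ, hX.incl a x = f x := by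
  have h1 : ∀ᵐ x ∂μ, AEEqFun.mk f hf x = f x := AEEqFun.coeFn_mk f hf
  obtain ⟨a, ha⟩ := hX.exists_incl_eq (hX.ideal _ (hX.incl_mem b) (AEEqFun.mk f hf) (by
    filter_upwards [h, h1] with x h2 h3
    rwa [h3])).1
  exact ⟨a, by rwa [ha]⟩

theorem exists_of_le_mul {f : Ω → ℝ} (hf : AEStronglyMeasurable f μ) (b : hX.Space) (c : ℝ)
    (h : ∀ᵐ x ∂μ, |f x| ≤ c * |hX.incl b x|) : ∃ a, ∀ᵐ x ∂μ, hX.incl a x = f x := by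
  refine exists_of_le hf (c • b) ?_
  filter_upwards [h, hX.incl_smul c b] with x h1 h2
  rw [h2, abs_mul]
  exact h1.trans (mul_le_mul_of_nonneg_right (le_abs_self c) (abs_nonneg _))

theorem exists_abs (a : hX.Space) : ∃ b, ∀ᵐ x ∂μ, hX.incl b x = |hX.incl a x| :=
  exists_of_le (AEEqFun.aestronglyMeasurable (hX.incl a)).norm a (by simp)

/-- The positive cone of a Banach function space is closed. -/
theorem ae_nonneg_of_tendsto {v : ℕ → hX.Space} {a : hX.Space} (hv : Tendsto v atTop (𝓝 a))
    (h : ∀ᶠ n in atTop, ∀ᵐ x ∂μ, 0 ≤ hX.incl (v n) x) : ∀ᵐ x ∂μ, 0 ≤ hX.incl a x := by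
  -- b is the negative part of a. Since v n ≥ 0, it is dominated by |v n - a|, so its norm is at
  -- most ‖v n - a‖ → 0.
  obtain ⟨b, hb⟩ := exists_of_le (hX := hX) (f := fun x => max (-hX.incl a x) 0)
    (((AEEqFun.aestronglyMeasurable _).neg).sup aestronglyMeasurable_const) a (by
      refine Eventually.of_forall fun x => ?_
      rw [abs_of_nonneg (le_max_right _ _)]
      exact max_le (neg_le_abs _) (abs_nonneg _))
  have h0 : ‖b‖ ≤ 0 := by
    refine ge_of_tendsto (tendsto_iff_norm_sub_tendsto_zero.1 hv) ?_
    filter_upwards [h] with n hn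
    refine norm_le_of_ae ?_
    filter_upwards [hn, hb, hX.incl_sub (v n) a] with x h1 h2 h3
    rw [h2, h3, abs_of_nonneg (le_max_right _ _)]
    refine max_le ?_ (abs_nonneg _)
    exact le_trans (by linarith) (le_abs_self _)
  have h1 : b = 0 := norm_le_zero_iff.1 h0
  subst h1
  filter_upwards [hb, hX.incl_zero] with x h2 h3
  rw [h3] at h2
  have := le_max_left (-hX.incl a x) 0
  linarith

theorem ae_le_of_tendsto {v : ℕ → hX.Space} {a b : hX.Space} (hv : Tendsto v atTop (𝓝 a))
    (h : ∀ᶠ n in atTop, ∀ᵐ x ∂μ, hX.incl b x ≤ hX.incl (v n) x) :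
    ∀ᵐ x ∂μ, hX.incl b x ≤ hX.incl a x := by
  have := ae_nonneg_of_tendsto (hv.sub_const b) (by
    filter_upwards [h] with n hn
    filter_upwards [hn, hX.incl_sub (v n) b] with x h1 h2
    rw [h2]; linarith)
  filter_upwards [this, hX.incl_sub a b] with x h1 h2
  rw [h2] at h1; linarith

/-- A sequence of positive elements with summable norms has an upper bound. -/
theorem exists_bound_of_summable {w : ℕ → hX.Space} (h0 : ∀ n, ∀ᵐ x ∂μ, 0 ≤ hX.incl (w n) x)
    (hw : Summable fun n => ‖w n‖) : ∃ h, ∀ n, ∀ᵐ x ∂μ, hX.incl (w n) x ≤ hX.incl h x := by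
  -- The bound is the sum of the series: its partial sums eventually dominate w n, and the order
  -- passes to the limit.
  refine ⟨∑' n, w n, fun n => ae_le_of_tendsto hw.of_norm.hasSum.tendsto_sum_nat ?_⟩
  filter_upwards [eventually_gt_atTop n] with N hN
  filter_upwards [hX.incl_sum (Finset.range N) w, ae_all_iff.2 h0] with x h1 h2
  rw [h1]
  exact Finset.single_le_sum (f := fun i => hX.incl (w i) x) (fun i _ => h2 i)
    (Finset.mem_range.2 hN)

end FnSpace.IsBanachFunctionSpace

/-! ### Pointwise formulas for powers and ℓ^q-sums -/

section Pointwise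

variable {Ω : Type*} {mΩ : MeasurableSpace Ω} {μ : Measure Ω}

theorem absPow_ae (p : ℝ) (f : L0 μ) : ∀ᵐ x ∂μ, absPow p f x = |f x| ^ p :=
  AEEqFun.coeFn_mk _ _

theorem lqSum_ae (q : ℝ) {n : ℕ} (f : Fin n → L0 μ) :
    ∀ᵐ x ∂μ, lqSum q f x = (∑ j, |f j x| ^ q) ^ (1 / q) :=
  AEEqFun.coeFn_mk _ _

theorem lqSum_pointwise_le {q : ℝ} (hq : 0 < q) {n : ℕ} (a : Fin n → ℝ) :
    (∑ j, |a j| ^ q) ^ (1 / q) ≤ (n : ℝ) ^ (1 / q) * ∑ j, |a j| := by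
  have h0 : 0 ≤ ∑ j, |a j| := Finset.sum_nonneg fun _ _ => abs_nonneg _
  have h1 : ∑ j, |a j| ^ q ≤ n * (∑ j, |a j|) ^ q := by
    refine (Finset.sum_le_card_nsmul Finset.univ _ ((∑ j, |a j|) ^ q) fun j _ => ?_).trans ?_
    · exact Real.rpow_le_rpow (abs_nonneg _)
        (Finset.single_le_sum (f := fun j => |a j|) (fun i _ => abs_nonneg _)
          (Finset.mem_univ j)) hq.le
    · simp
  calc (∑ j, |a j| ^ q) ^ (1 / q) ≤ (n * (∑ j, |a j|) ^ q) ^ (1 / q) :=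
        Real.rpow_le_rpow (Finset.sum_nonneg fun _ _ => by positivity) h1 (by positivity)
    _ = _ := by
        rw [Real.mul_rpow (by positivity) (by positivity), ← Real.rpow_mul h0,
          mul_one_div_cancel hq.ne', Real.rpow_one]

end Pointwise

/-! ### Powers of a Banach function space as quasi-normed ideals -/

namespace FnSpace

variable {Ω : Type*} {mΩ : MeasurableSpace Ω} {μ : Measure Ω} {X Z : FnSpace μ}

theorem IsBanachFunctionSpace.lqSum_mem (hX : X.IsBanachFunctionSpace) {q : ℝ} (hq : 0 < q)
    {n : ℕ} {f : Fin n → L0 μ} (hf : ∀ j, f j ∈ X.carrier) : lqSum q f ∈ X.carrier := by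
  choose e he using fun j => hX.exists_incl_eq (hf j)
  choose a ha using fun j => IsBanachFunctionSpace.exists_abs (e j)
  obtain ⟨b, hb⟩ := IsBanachFunctionSpace.exists_of_le_mul (hX := hX)
    (f := lqSum q f) (AEEqFun.aestronglyMeasurable _) (∑ j, a j) ((n : ℝ) ^ (1 / q)) (by
      filter_upwards [lqSum_ae q f, hX.incl_sum Finset.univ a, ae_all_iff.2 ha] with x h1 h2 h3
      rw [h1, h2, abs_of_nonneg (Real.rpow_nonneg (Finset.sum_nonneg fun _ _ => by positivity) _)]
      simp only [h3, he]
      rw [abs_of_nonneg (Finset.sum_nonneg fun _ _ => abs_nonneg _)]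
      exact lqSum_pointwise_le hq fun j => f j x)
  have : hX.incl b = lqSum q f := AEEqFun.ext hb
  exact this ▸ hX.incl_mem b

section Power

variable (hZ : Z.IsBanachFunctionSpace) {r : ℝ} (hr : 0 < r)

include hZ

theorem power_qnorm_nonneg {f : L0 μ} (hf : f ∈ (Z.power r).carrier) :
    0 ≤ (Z.power r).qnorm f :=
  Real.rpow_nonneg (hZ.norm_nonneg _ hf) _

include hr

theorem power_qnorm_rpow {f : L0 μ} (hf : f ∈ (Z.power r).carrier) :
    (Z.power r).qnorm f ^ r = Z.qnorm (absPow r f) := by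
  change (Z.qnorm (absPow r f) ^ (1 / r)) ^ r = _
  rw [← Real.rpow_mul (hZ.norm_nonneg _ hf), one_div_mul_cancel hr.ne', Real.rpow_one]

theorem power_of_le_mul {f g : L0 μ} (hf : f ∈ (Z.power r).carrier) {c : ℝ} (hc : 0 ≤ c)
    (h : ∀ᵐ x ∂μ, |g x| ≤ c * |f x|) :
    g ∈ (Z.power r).carrier ∧ (Z.power r).qnorm g ≤ c * (Z.power r).qnorm f := by
  have hle : ∀ᵐ x ∂μ, |absPow r g x| ≤ |(c ^ r • absPow r f : L0 μ) x| := by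
    filter_upwards [h, absPow_ae r f, absPow_ae r g,
      AEEqFun.coeFn_smul (c ^ r) (absPow r f)] with x h1 h2 h3 h4
    rw [h4, Pi.smul_apply, h2, h3, smul_eq_mul, abs_of_nonneg (Real.rpow_nonneg (abs_nonneg _) _),
      abs_of_nonneg (a := c ^ r * |f x| ^ r) (by positivity), ← Real.mul_rpow hc (abs_nonneg _)]
    exact Real.rpow_le_rpow (abs_nonneg _) h1 hr.le
  obtain ⟨h1, h2⟩ := hZ.ideal _ (hZ.smul_mem (c ^ r) _ hf) _ hle
  refine ⟨h1, ?_⟩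
  rw [hZ.norm_smul _ _ hf, abs_of_nonneg (Real.rpow_nonneg hc r)] at h2
  change Z.qnorm (absPow r g) ^ (1 / r) ≤ c * Z.qnorm (absPow r f) ^ (1 / r)
  refine (Real.rpow_le_rpow (hZ.norm_nonneg _ h1) h2 (by positivity)).trans_eq ?_
  rw [Real.mul_rpow (by positivity) (hZ.norm_nonneg _ hf), ← Real.rpow_mul hc,
    mul_one_div_cancel hr.ne', Real.rpow_one]

/-- For every r > 0, (a + b)^r ≤ 2^r max(a, b)^r ≤ 2^r (a^r + b^r); this suffices for membership,
where constants do not matter. -/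
theorem power_of_le_add {f g k : L0 μ} (hf : f ∈ (Z.power r).carrier)
    (hg : g ∈ (Z.power r).carrier) (h : ∀ᵐ x ∂μ, |k x| ≤ |f x| + |g x|) :
    k ∈ (Z.power r).carrier := by
  refine (hZ.ideal _ (hZ.smul_mem (2 ^ r) _ (hZ.add_mem _ hf _ hg)) (absPow r k) ?_).1
  filter_upwards [h, absPow_ae r f, absPow_ae r g, absPow_ae r k,
    AEEqFun.coeFn_smul (2 ^ r : ℝ) (absPow r f + absPow r g),
    AEEqFun.coeFn_add (absPow r f) (absPow r g)] with x h1 h2 h3 h4 h5 h6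
  rw [h5, Pi.smul_apply, h6, Pi.add_apply, h2, h3, h4, smul_eq_mul,
    abs_of_nonneg (Real.rpow_nonneg (abs_nonneg _) _),
    abs_of_nonneg (a := 2 ^ r * (|f x| ^ r + |g x| ^ r)) (by positivity)]
  have h7 : |k x| ≤ 2 * max |f x| |g x| := by
    have := le_max_left |f x| |g x|
    have := le_max_right |f x| |g x|
    linarith
  refine (Real.rpow_le_rpow (abs_nonneg _) h7 hr.le).trans ?_
  rw [Real.mul_rpow (by norm_num) (by positivity)]
  refine mul_le_mul_of_nonneg_left ?_ (by positivity)
  have h8 : 0 ≤ |f x| ^ r := by positivity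
  have h9 : 0 ≤ |g x| ^ r := by positivity
  rcases max_choice |f x| |g x| with h | h <;> rw [h] <;> linarith

theorem power_zero_mem : (0 : L0 μ) ∈ (Z.power r).carrier := by
  refine (hZ.ideal _ hZ.zero_mem _ ?_).1
  filter_upwards [absPow_ae r (0 : L0 μ), AEEqFun.coeFn_zero (β := ℝ) (μ := μ)] with x h1 h2
  rw [h1, h2]
  simp [hr.ne']

theorem power_add_mem {f g : L0 μ} (hf : f ∈ (Z.power r).carrier)
    (hg : g ∈ (Z.power r).carrier) : f + g ∈ (Z.power r).carrier := by
  refine power_of_le_add hZ hr hf hg ?_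
  filter_upwards [AEEqFun.coeFn_add f g] with x h
  rw [h]
  exact abs_add_le _ _

theorem power_smul (c : ℝ) {f : L0 μ} (hf : f ∈ (Z.power r).carrier) :
    c • f ∈ (Z.power r).carrier ∧ (Z.power r).qnorm (c • f) ≤ |c| * (Z.power r).qnorm f := by
  refine power_of_le_mul hZ hr hf (abs_nonneg c) ?_
  filter_upwards [AEEqFun.coeFn_smul c f] with x h
  rw [h, Pi.smul_apply, smul_eq_mul, abs_mul]

theorem power_qnorm_zero : (Z.power r).qnorm 0 = 0 := by
  have h := (power_smul hZ hr 0 (power_zero_mem hZ hr)).2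
  rw [zero_smul, abs_zero, zero_mul] at h
  exact le_antisymm h (power_qnorm_nonneg hZ (power_zero_mem hZ hr))

theorem eq_zero_of_power_qnorm {f : L0 μ} (hf : f ∈ (Z.power r).carrier)
    (h : (Z.power r).qnorm f = 0) : f = 0 := by
  have h1 : absPow r f = 0 := by
    rw [← hZ.norm_eq_zero_iff _ hf, ← power_qnorm_rpow hZ hr hf, h, Real.zero_rpow hr.ne']
  refine AEEqFun.ext ?_
  filter_upwards [absPow_ae r f, AEEqFun.coeFn_zero (β := ℝ) (μ := μ)] with x h2 h3
  rw [h1, h3] at h2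
  rw [h3]
  simpa using (Real.rpow_eq_zero (abs_nonneg _) hr.ne').1 h2.symm

/-- In a power of a Banach function space, a sequence whose quasi-norms decrease fast is
relatively uniformly convergent to zero. -/
theorem power_exists_regulator {g : ℕ → L0 μ} (hg : ∀ n, g n ∈ (Z.power r).carrier)
    (hN : ∀ n, (Z.power r).qnorm (g n) ≤ (1 / 4) ^ n) :
    ∃ H ∈ (Z.power r).carrier, ∀ n, ∀ᵐ x ∂μ, |g n x| ≤ (1 / 2) ^ n * |H x| := by
  -- Half of the decay 4⁻ⁿ is spent on the factor 2ⁿ. The other half leaves (2ⁿ|g n|)^r with norm at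
  -- most (2^(-r))ⁿ in Z, which is summable, so these functions have a common bound h.
  have hm : ∀ n, (2 ^ n : ℝ) • g n ∈ (Z.power r).carrier := fun n => (power_smul hZ hr _ (hg n)).1
  choose w hw using fun n => hZ.exists_incl_eq (hm n)
  have hwx : ∀ n, ∀ᵐ x ∂μ, hZ.incl (w n) x = (2 ^ n * |g n x|) ^ r := by
    intro n
    filter_upwards [absPow_ae r ((2 ^ n : ℝ) • g n), AEEqFun.coeFn_smul (2 ^ n : ℝ) (g n)]
      with x h1 h2
    rw [hw, h1, h2, Pi.smul_apply, smul_eq_mul, abs_mul, abs_of_nonneg (by positivity)]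
  have hwn : ∀ n, ‖w n‖ ≤ ((1 / 2 : ℝ) ^ r) ^ n := by
    intro n
    have hcomm : ((1 / 2 : ℝ) ^ r) ^ n = ((1 / 2 : ℝ) ^ n) ^ r := by
      rw [← Real.rpow_natCast, ← Real.rpow_mul (by norm_num), mul_comm r,
        Real.rpow_mul (by norm_num), Real.rpow_natCast]
    rw [hZ.norm_eq, hw, ← power_qnorm_rpow hZ hr (hm n), hcomm]
    refine Real.rpow_le_rpow (power_qnorm_nonneg hZ (hm n)) ?_ hr.le
    refine (power_smul hZ hr _ (hg n)).2.trans ?_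
    rw [abs_of_nonneg (by positivity)]
    refine (mul_le_mul_of_nonneg_left (hN n) (by positivity)).trans_eq ?_
    rw [← mul_pow]; norm_num
  obtain ⟨h, hh⟩ := IsBanachFunctionSpace.exists_bound_of_summable (w := w)
    (fun n => by filter_upwards [hwx n] with x hx; rw [hx]; positivity)
    (Summable.of_nonneg_of_le (fun _ => norm_nonneg _) hwn (summable_geometric_of_lt_one
      (by positivity) (Real.rpow_lt_one (by norm_num) (by norm_num) hr)))
  -- The regulator is H = |h|^(1/r), which undoes the r-th power taken above.
  refine ⟨absPow (1 / r) (hZ.incl h), (hZ.ideal _ (hZ.incl_mem h) _ ?_).1, fun n => ?_⟩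
  · filter_upwards [absPow_ae r (absPow (1 / r) (hZ.incl h)), absPow_ae (1 / r) (hZ.incl h)]
      with x h1 h2
    rw [h1, h2, abs_of_nonneg (a := |hZ.incl h x| ^ (1 / r)) (by positivity),
      ← Real.rpow_mul (abs_nonneg _), one_div_mul_cancel hr.ne', Real.rpow_one, abs_abs]
  · filter_upwards [hwx n, hh n, absPow_ae (1 / r) (hZ.incl h)] with x h1 h2 h3
    rw [h3, abs_of_nonneg (a := |hZ.incl h x| ^ (1 / r)) (by positivity)]
    rw [h1] at h2
    have h4 : 2 ^ n * |g n x| ≤ |hZ.incl h x| ^ (1 / r) := by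
      have := Real.rpow_le_rpow (by positivity) (h2.trans (le_abs_self _))
        (z := 1 / r) (by positivity)
      rwa [← Real.rpow_mul (by positivity), mul_one_div_cancel hr.ne', Real.rpow_one] at this
    calc |g n x| = (1 / 2) ^ n * (2 ^ n * |g n x|) := by
          rw [← mul_assoc, ← mul_pow]; norm_num
      _ ≤ _ := mul_le_mul_of_nonneg_left h4 (by positivity)

end Power

/-! ### The upper estimate for sums in Z^r -/

/-- The upper estimate `‖g‖ ≤ D ∑ ‖f_j‖` for `|g| ≤ ∑ |f_j|`. -/
def HasSumEstimate (X : FnSpace μ) (D : ℝ) : Prop :=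
  ∀ l : List (L0 μ), (∀ f ∈ l, f ∈ X.carrier) → ∀ g ∈ X.carrier,
    (∀ᵐ x ∂μ, |g x| ≤ (l.map fun f : L0 μ => |f x|).sum) → X.qnorm g ≤ D * (l.map X.qnorm).sum

/-- This is Minkowski's inequality for the power. With a = ‖f‖ and b = ‖g‖, the number (|f| +
|g|)/(a + b) is a convex combination of |f|/a and |g|/b, so convexity of t ↦ t^r bounds its r-th
power by an element of Z of norm at most 1. -/
theorem power_hasSumEstimate_of_one_le (hZ : Z.IsBanachFunctionSpace) {r : ℝ} (hr : 1 ≤ r) :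
    (Z.power r).HasSumEstimate 1 := by
  have hr0 : 0 < r := by linarith
  have tri : ∀ f ∈ (Z.power r).carrier, ∀ g ∈ (Z.power r).carrier, ∀ k : L0 μ,
      (∀ᵐ x ∂μ, |k x| ≤ |f x| + |g x|) →
      (Z.power r).qnorm k ≤ (Z.power r).qnorm f + (Z.power r).qnorm g := by
    intro f hf g hg k hk
    have hkm := power_of_le_add hZ hr0 hf hg hk
    set a := (Z.power r).qnorm f with ha
    set b := (Z.power r).qnorm g with hb
    -- The normalisation divides by both quasi-norms, so a vanishing one is treated separately; the
    -- corresponding function is then zero.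
    rcases (power_qnorm_nonneg hZ hf).eq_or_lt with h0 | h0
    · have := eq_zero_of_power_qnorm hZ hr0 hf h0.symm
      have h1 := (power_of_le_mul hZ hr0 hg zero_le_one (g := k) (by
        filter_upwards [hk, AEEqFun.coeFn_zero (β := ℝ) (μ := μ)] with x h1 h2
        rw [this, h2] at h1
        simpa using h1)).2
      rw [ha, ← h0, hb]
      linarith
    rcases (power_qnorm_nonneg hZ hg).eq_or_lt with h0' | h0'
    · have := eq_zero_of_power_qnorm hZ hr0 hg h0'.symm
      have h1 := (power_of_le_mul hZ hr0 hf zero_le_one (g := k) (by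
        filter_upwards [hk, AEEqFun.coeFn_zero (β := ℝ) (μ := μ)] with x h1 h2
        rw [this, h2] at h1
        simpa using h1)).2
      rw [hb, ← h0', ha]
      linarith
    rw [← ha] at h0
    rw [← hb] at h0'
    have hab : 0 < a + b := by positivity
    obtain ⟨zf, hzf⟩ := hZ.exists_incl_eq hf
    obtain ⟨zg, hzg⟩ := hZ.exists_incl_eq hg
    obtain ⟨zk, hzk⟩ := hZ.exists_incl_eq hkm
    have hle : ‖zk‖ ≤ ‖(a + b) ^ r • ((a / (a + b) / a ^ r) • zf + (b / (a + b) / b ^ r) • zg)‖ := by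
      refine IsBanachFunctionSpace.norm_le_of_ae ?_
      filter_upwards [hk, absPow_ae r f, absPow_ae r g, absPow_ae r k,
        hZ.incl_smul ((a + b) ^ r) ((a / (a + b) / a ^ r) • zf + (b / (a + b) / b ^ r) • zg),
        hZ.incl_add ((a / (a + b) / a ^ r) • zf) ((b / (a + b) / b ^ r) • zg),
        hZ.incl_smul (a / (a + b) / a ^ r) zf, hZ.incl_smul (b / (a + b) / b ^ r) zg]
        with x h1 h2 h3 h4 h5 h6 h7 h8
      rw [h5, h6, h7, h8, hzf, hzg, hzk, h2, h3, h4,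
        abs_of_nonneg (Real.rpow_nonneg (abs_nonneg _) _),
        abs_of_nonneg (a := (a + b) ^ r * (a / (a + b) / a ^ r * |f x| ^ r
          + b / (a + b) / b ^ r * |g x| ^ r)) (by positivity)]
      have hfa : 0 ≤ |f x| / a := by positivity
      have hgb : 0 ≤ |g x| / b := by positivity
      have ha' : 0 ≤ a / (a + b) := by positivity
      have hb' : 0 ≤ b / (a + b) := by positivity
      have hc := (convexOn_rpow hr).2 (mem_Ici.2 hfa) (mem_Ici.2 hgb) ha' hb' (by field_simp)
      simp only [smul_eq_mul] at hc
      have e1 : a / (a + b) * (|f x| / a) + b / (a + b) * (|g x| / b)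
          = (|f x| + |g x|) / (a + b) := by field_simp
      rw [e1, Real.div_rpow (by positivity) hab.le, div_le_iff₀ (by positivity),
        Real.div_rpow (by positivity) h0.le, Real.div_rpow (by positivity) h0'.le] at hc
      refine (Real.rpow_le_rpow (abs_nonneg _) h1 hr0.le).trans (hc.trans_eq ?_)
      ring
    have nf : ‖zf‖ = a ^ r := by rw [hZ.norm_eq, hzf, ha, power_qnorm_rpow hZ hr0 hf]
    have ng : ‖zg‖ = b ^ r := by rw [hZ.norm_eq, hzg, hb, power_qnorm_rpow hZ hr0 hg]
    have nk : ‖zk‖ = (Z.power r).qnorm k ^ r := by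
      rw [hZ.norm_eq, hzk, power_qnorm_rpow hZ hr0 hkm]
    rw [norm_smul, nk] at hle
    have h2 : ‖(a / (a + b) / a ^ r) • zf + (b / (a + b) / b ^ r) • zg‖ ≤ 1 := by
      refine (norm_add_le _ _).trans_eq ?_
      rw [norm_smul, norm_smul, nf, ng, Real.norm_of_nonneg (by positivity),
        Real.norm_of_nonneg (by positivity), div_mul_cancel₀ _ (by positivity),
        div_mul_cancel₀ _ (by positivity)]
      field_simp
    have h3 := hle.trans (mul_le_mul_of_nonneg_left h2 (norm_nonneg _))
    rw [mul_one, Real.norm_of_nonneg (by positivity)] at h3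
    exact (Real.rpow_le_rpow_iff (power_qnorm_nonneg hZ hkm) hab.le hr0).1 h3
  have key : ∀ l : List (L0 μ), (∀ f ∈ l, f ∈ (Z.power r).carrier) →
      ∃ k ∈ (Z.power r).carrier, (∀ᵐ x ∂μ, k x = (l.map fun f : L0 μ => |f x|).sum) ∧
        (Z.power r).qnorm k ≤ (l.map (Z.power r).qnorm).sum := by
    intro l
    induction l with
    | nil =>
      exact fun _ => ⟨0, power_zero_mem hZ hr0, AEEqFun.coeFn_zero,
        (power_qnorm_zero hZ hr0).le⟩
    | cons f l ih =>
      intro hl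
      obtain ⟨k, hk, hkx, hkn⟩ := ih fun g hg => hl g (List.mem_cons_of_mem _ hg)
      have hf := hl f List.mem_cons_self
      have hx : ∀ᵐ x ∂μ, (|f| + k : L0 μ) x = |f x| + k x := by
        filter_upwards [AEEqFun.coeFn_add |f| k, AEEqFun.coeFn_abs f] with x h1 h2
        rw [h1, Pi.add_apply, h2]
      have hle : ∀ᵐ x ∂μ, |(|f| + k : L0 μ) x| ≤ |f x| + |k x| := by
        filter_upwards [hx] with x h1
        rw [h1]
        exact (abs_add_le _ _).trans (by rw [abs_abs])
      refine ⟨|f| + k, power_of_le_add hZ hr0 hf hk hle, ?_, ?_⟩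
      · filter_upwards [hx, hkx] with x h1 h2
        rw [h1, h2, List.map_cons, List.sum_cons]
      · rw [List.map_cons, List.sum_cons]
        exact (tri f hf k hk _ hle).trans (by linarith)
  intro l hl g _ hgx
  obtain ⟨k, hk, hkx, hkn⟩ := key l hl
  have := (power_of_le_mul hZ hr0 hk zero_le_one (g := g) (by
    filter_upwards [hgx, hkx] with x h1 h2
    rw [one_mul, h2]
    exact h1.trans (le_abs_self _))).2
  linarith

/-- Apply p-convexity to the functions |f_j|^(1/p). Their ℓ^p-sum is (∑ |f_j|)^(1/p), which
dominates |g|^(1/p); raising the inequality to the power p turns C into C^p. -/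
theorem power_hasSumEstimate_of_isConvexWith (hZ : Z.IsBanachFunctionSpace) {p C : ℝ} (hp : 0 < p)
    (hC : 0 < C) (hconv : Z.IsConvexWith p C) : (Z.power (1 / p)).HasSumEstimate (C ^ p) := by
  intro l hl g hg hgx
  have hr : 0 < 1 / p := by positivity
  have hmem : ∀ j : Fin l.length, absPow (1 / p) l[j] ∈ Z.carrier :=
    fun j => hl _ (List.getElem_mem _)
  have hnn : ∀ j : Fin l.length, 0 ≤ Z.qnorm (absPow (1 / p) l[j]) :=
    fun j => hZ.norm_nonneg _ (hmem j)
  have h1 := hconv l.length (fun j => absPow (1 / p) l[j]) hmem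
  have h2 : Z.qnorm (absPow (1 / p) g) ≤ Z.qnorm (lqSum p fun j : Fin l.length =>
      absPow (1 / p) l[j]) := by
    refine (hZ.ideal _ (hZ.lqSum_mem hp hmem) _ ?_).2
    filter_upwards [hgx, absPow_ae (1 / p) g, lqSum_ae p fun j : Fin l.length =>
      absPow (1 / p) l[j], ae_all_iff.2 fun j : Fin l.length => absPow_ae (1 / p) l[j]]
      with x h2 h3 h4 h5
    have h6 : ∑ j : Fin l.length, |absPow (1 / p) l[j] x| ^ p
        = (l.map fun f : L0 μ => |f x|).sum := by
      rw [← List.sum_ofFn]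
      congr 1
      refine List.ext_getElem (by simp) fun i hi1 hi2 => ?_
      rw [List.length_ofFn] at hi1
      have := h5 ⟨i, hi1⟩
      simp only [List.getElem_ofFn, List.getElem_map]
      simp only [Fin.getElem_fin] at this ⊢
      rw [this, abs_of_nonneg (by positivity), ← Real.rpow_mul (abs_nonneg _),
        one_div_mul_cancel hp.ne', Real.rpow_one]
    rw [h3, h4, h6, abs_of_nonneg (by positivity)]
    exact (Real.rpow_le_rpow (abs_nonneg _) h2 hr.le).trans (le_abs_self _)
  have h3 : (l.map (Z.power (1 / p)).qnorm).sum
      = ∑ j : Fin l.length, Z.qnorm (absPow (1 / p) l[j]) ^ p := by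
    rw [← List.sum_ofFn]
    congr 1
    refine List.ext_getElem (by simp) fun i hi1 hi2 => ?_
    simp [power]
  rw [h3]
  change Z.qnorm (absPow (1 / p) g) ^ (1 / (1 / p)) ≤ _
  rw [one_div_one_div]
  refine (Real.rpow_le_rpow (hZ.norm_nonneg _ hg) (h2.trans h1) hp.le).trans_eq ?_
  have h4 : 0 ≤ ∑ j : Fin l.length, Z.qnorm (absPow (1 / p) l[j]) ^ p :=
    Finset.sum_nonneg fun j _ => Real.rpow_nonneg (hnn j) _
  rw [Real.mul_rpow hC.le (Real.rpow_nonneg h4 _), ← Real.rpow_mul h4,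
    one_div_mul_cancel hp.ne', Real.rpow_one]

end FnSpace

/-! ### Renorming Z^r as a Banach function space -/

namespace FnSpace

variable {Ω : Type*} {mΩ : MeasurableSpace Ω} {μ : Measure Ω} {X Z : FnSpace μ}

/-- The values `∑ ‖f_j‖` for the finite families in `X` with `|g| ≤ ∑ |f_j|`. -/
def sumBounds (X : FnSpace μ) (g : L0 μ) : Set ℝ :=
  {t | ∃ l : List (L0 μ), (∀ f ∈ l, f ∈ X.carrier) ∧
    (∀ᵐ x ∂μ, |g x| ≤ (l.map fun f : L0 μ => |f x|).sum) ∧ t = (l.map X.qnorm).sum}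

/-- The same space with the largest monotone norm below the given quasi-norm. -/
def renorm (X : FnSpace μ) : FnSpace μ where
  carrier := X.carrier
  qnorm g := sInf (X.sumBounds g)

section Renorm

variable (h0 : ∀ f ∈ X.carrier, 0 ≤ X.qnorm f)

include h0

theorem nonneg_of_mem_sumBounds {g : L0 μ} {t : ℝ} (ht : t ∈ X.sumBounds g) : 0 ≤ t := by
  obtain ⟨l, hl, -, rfl⟩ := ht
  refine List.sum_nonneg fun x hx => ?_
  obtain ⟨f, hf, rfl⟩ := List.mem_map.1 hx
  exact h0 f (hl f hf)

theorem bddBelow_sumBounds (g : L0 μ) : BddBelow (X.sumBounds g) :=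
  ⟨0, fun _ ht => nonneg_of_mem_sumBounds h0 ht⟩

omit h0 in
theorem qnorm_mem_sumBounds {g : L0 μ} (hg : g ∈ X.carrier) : X.qnorm g ∈ X.sumBounds g :=
  ⟨[g], by simpa using hg, by simp, by simp⟩

theorem renorm_qnorm_le {g : L0 μ} (hg : g ∈ X.carrier) : X.renorm.qnorm g ≤ X.qnorm g :=
  csInf_le (bddBelow_sumBounds h0 g) (qnorm_mem_sumBounds hg)

theorem renorm_qnorm_nonneg (g : L0 μ) : 0 ≤ X.renorm.qnorm g :=
  Real.sInf_nonneg fun _ ht => nonneg_of_mem_sumBounds h0 ht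

/-- Concatenating a family for f with one for g gives a family for f + g; the triangle inequality
thus needs no convexity. -/
theorem renorm_qnorm_add_le {f g : L0 μ} (hf : f ∈ X.carrier) (hg : g ∈ X.carrier) :
    X.renorm.qnorm (f + g) ≤ X.renorm.qnorm f + X.renorm.qnorm g := by
  refine le_of_forall_pos_le_add fun ε hε => ?_
  obtain ⟨s, ⟨l, hl, hlx, rfl⟩, hs⟩ := exists_lt_of_csInf_lt ⟨_, qnorm_mem_sumBounds hf⟩
    (lt_add_of_pos_right (sInf (X.sumBounds f)) (half_pos hε))
  obtain ⟨t, ⟨l', hl', hlx', rfl⟩, ht⟩ := exists_lt_of_csInf_lt ⟨_, qnorm_mem_sumBounds hg⟩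
    (lt_add_of_pos_right (sInf (X.sumBounds g)) (half_pos hε))
  have hm : (l.map X.qnorm).sum + (l'.map X.qnorm).sum ∈ X.sumBounds (f + g) := by
    refine ⟨l ++ l', fun k hk => (List.mem_append.1 hk).elim (hl k) (hl' k), ?_, by simp⟩
    filter_upwards [hlx, hlx', AEEqFun.coeFn_add f g] with x h1 h2 h3
    rw [h3, Pi.add_apply, List.map_append, List.sum_append]
    exact (abs_add_le _ _).trans (add_le_add h1 h2)
  have := csInf_le (bddBelow_sumBounds h0 _) hm
  change sInf (X.sumBounds (f + g)) ≤ sInf (X.sumBounds f) + sInf (X.sumBounds g) + ε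
  linarith

theorem renorm_qnorm_mono {f g : L0 μ} (hf : f ∈ X.carrier) (h : ∀ᵐ x ∂μ, |g x| ≤ |f x|) :
    X.renorm.qnorm g ≤ X.renorm.qnorm f := by
  refine csInf_le_csInf (bddBelow_sumBounds h0 g) ⟨_, qnorm_mem_sumBounds hf⟩ ?_
  rintro t ⟨l, hl, hlx, rfl⟩
  refine ⟨l, hl, ?_, rfl⟩
  filter_upwards [h, hlx] with x h1 h2 using h1.trans h2

-- The only place where the sum estimate enters the renorming: it keeps the infimum from collapsing.
omit h0 in
theorem qnorm_le_mul_renorm_qnorm {D : ℝ} (hD : 0 < D) (hX : X.HasSumEstimate D) {g : L0 μ}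
    (hg : g ∈ X.carrier) : X.qnorm g ≤ D * X.renorm.qnorm g := by
  have : D⁻¹ * X.qnorm g ≤ X.renorm.qnorm g := by
    refine le_csInf ⟨_, qnorm_mem_sumBounds hg⟩ ?_
    rintro t ⟨l, hl, hlx, rfl⟩
    rw [inv_mul_le_iff₀ hD]
    exact hX l hl g hg hlx
  rwa [inv_mul_le_iff₀ hD] at this

end Renorm

section PowerRenorm

variable (hZ : Z.IsBanachFunctionSpace) {r : ℝ} (hr : 0 < r) {D : ℝ} (hD : 0 < D)
  (hsum : (Z.power r).HasSumEstimate D)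

include hZ hr

/-- Scaling a family for f gives one for c • f. The reverse inequality follows later by applying
this one to c⁻¹. -/
theorem renorm_qnorm_smul_le (c : ℝ) {f : L0 μ} (hf : f ∈ (Z.power r).carrier) :
    (Z.power r).renorm.qnorm (c • f) ≤ |c| * (Z.power r).renorm.qnorm f := by
  have h0 : ∀ f ∈ (Z.power r).carrier, 0 ≤ (Z.power r).qnorm f :=
    fun f hf => power_qnorm_nonneg hZ hf
  rcases eq_or_ne c 0 with rfl | hc
  · rw [zero_smul, abs_zero, zero_mul]
    refine (renorm_qnorm_le h0 (power_zero_mem hZ hr)).trans (power_qnorm_zero hZ hr).le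
  have hc' : 0 < |c| := abs_pos.2 hc
  rw [← inv_mul_le_iff₀ hc']
  refine le_csInf ⟨_, qnorm_mem_sumBounds hf⟩ ?_
  rintro t ⟨l, hl, hlx, rfl⟩
  rw [inv_mul_le_iff₀ hc']
  have hm : ((l.map (c • ·)).map (Z.power r).qnorm).sum ∈ (Z.power r).sumBounds (c • f) := by
    refine ⟨l.map (c • ·), fun k hk => ?_, ?_, rfl⟩
    · obtain ⟨g, hg, rfl⟩ := List.mem_map.1 hk
      exact (power_smul hZ hr c (hl g hg)).1
    · have hs : ∀ᵐ x ∂μ, ((l.map (c • ·)).map fun f : L0 μ => |f x|).sum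
          = |c| * (l.map fun f : L0 μ => |f x|).sum := by
        clear hl hlx
        induction l with
        | nil => simp
        | cons g l ih =>
          filter_upwards [ih, AEEqFun.coeFn_smul c g] with x h1 h2
          rw [List.map_cons, List.map_cons, List.sum_cons, h1, h2, List.map_cons, List.sum_cons,
            Pi.smul_apply, smul_eq_mul, abs_mul, mul_add]
      filter_upwards [hs, hlx, AEEqFun.coeFn_smul c f] with x h1 h2 h3
      rw [h1, h3, Pi.smul_apply, smul_eq_mul, abs_mul]
      exact mul_le_mul_of_nonneg_left h2 hc'.le
  refine (csInf_le (bddBelow_sumBounds h0 _) hm).trans ?_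
  rw [← List.sum_map_mul_left, List.map_map]
  exact List.sum_le_sum fun g hg => (power_smul hZ hr c (hl g hg)).2

include hD hsum

/-- The substantial point is completeness. A fast subsequence has differences dominated by 2⁻ʲ|H|
for one fixed H, so it converges a.e. pointwise, and the same domination gives convergence in norm.
-/
theorem power_renorm_isBanachFunctionSpace : (Z.power r).renorm.IsBanachFunctionSpace := by
  have h0 : ∀ f ∈ (Z.power r).carrier, 0 ≤ (Z.power r).qnorm f :=
    fun f hf => power_qnorm_nonneg hZ hf
  refine ⟨power_zero_mem hZ hr, fun f hf g hg => power_add_mem hZ hr hf hg,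
    fun c f hf => (power_smul hZ hr c hf).1, fun f _ => renorm_qnorm_nonneg h0 f,
    fun f hf => ⟨fun h => ?_, ?_⟩, fun c f hf => ?_, fun f hf g hg => renorm_qnorm_add_le h0 hf hg,
    fun v hv hcau => ?_, fun f hf g h => ?_⟩
  · have h1 := qnorm_le_mul_renorm_qnorm hD hsum hf
    rw [h, mul_zero] at h1
    exact eq_zero_of_power_qnorm hZ hr hf (le_antisymm h1 (h0 f hf))
  · rintro rfl
    refine le_antisymm ?_ (renorm_qnorm_nonneg h0 _)
    exact (renorm_qnorm_le h0 hf).trans (power_qnorm_zero hZ hr).le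
  · refine le_antisymm (renorm_qnorm_smul_le hZ hr c hf) ?_
    rcases eq_or_ne c 0 with rfl | hc
    · rw [abs_zero, zero_mul]
      exact renorm_qnorm_nonneg h0 _
    · have := renorm_qnorm_smul_le hZ hr c⁻¹ (power_smul hZ hr c hf).1
      rwa [smul_smul, inv_mul_cancel₀ hc, one_smul, abs_inv, ← div_eq_inv_mul,
        le_div_iff₀ (abs_pos.2 hc), mul_comm] at this
  · have hsub : ∀ {f g : L0 μ}, f ∈ (Z.power r).carrier → g ∈ (Z.power r).carrier →
        f - g ∈ (Z.power r).carrier := by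
      intro f g hf hg
      rw [sub_eq_add_neg, ← neg_one_smul ℝ g]
      exact power_add_mem hZ hr hf (power_smul hZ hr _ hg).1
    -- The factor D⁻¹ makes the original quasi-norm of the differences at most 4⁻ʲ, as the regulator
    -- lemma requires.
    choose M hM using fun j : ℕ => hcau (D⁻¹ * (1 / 4) ^ j) (by positivity)
    -- Partial sums of M give indices with φ j ≥ M j and φ (j + 1) ≥ M j; no strict monotonicity is
    -- needed.
    let φ : ℕ → ℕ := fun j => ∑ i ∈ Finset.range (j + 1), M i
    have hφ : ∀ j, M j ≤ φ j := fun j =>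
      Finset.single_le_sum (f := M) (fun _ _ => zero_le) (Finset.mem_range.2 j.lt_succ_self)
    have hφ' : ∀ j, M j ≤ φ (j + 1) := fun j =>
      Finset.single_le_sum (f := M) (fun _ _ => zero_le) (Finset.mem_range.2 (by lia))
    obtain ⟨H, hH, hHx⟩ := power_exists_regulator hZ hr
      (g := fun j => v (φ (j + 1)) - v (φ j)) (fun j => hsub (hv _) (hv _)) (fun j => by
        refine (qnorm_le_mul_renorm_qnorm hD hsum (hsub (hv _) (hv _))).trans ?_
        have := hM j _ (hφ' j) _ (hφ j)
        rw [lt_inv_mul_iff₀ hD] at this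
        exact this.le)
    have hdist : ∀ᵐ x ∂μ, ∀ j, dist (v (φ j) x) (v (φ (j + 1)) x) ≤ |H x| * (1 / 2) ^ j := by
      rw [ae_all_iff]
      intro j
      filter_upwards [hHx j, AEEqFun.coeFn_sub (v (φ (j + 1))) (v (φ j))] with x h1 h2
      rw [h2, Pi.sub_apply] at h1
      rwa [dist_comm, Real.dist_eq, mul_comm]
    obtain ⟨w, hw, hwlim⟩ := exists_stronglyMeasurable_limit_of_tendsto_ae
      (f := fun j => (v (φ j) : Ω → ℝ)) (μ := μ)
      (fun j => AEEqFun.aestronglyMeasurable _) (by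
        filter_upwards [hdist] with x hx
        exact cauchySeq_tendsto_of_complete
          (cauchySeq_of_le_geometric (1 / 2) |H x| (by norm_num) hx))
    set k : L0 μ := AEEqFun.mk w hw.aestronglyMeasurable with hk
    have hkx : ∀ᵐ x ∂μ, k x = w x := AEEqFun.coeFn_mk _ _
    have hle : ∀ j, ∀ᵐ x ∂μ, |(v (φ j) - k : L0 μ) x| ≤ 2 * (1 / 2) ^ j * |H x| := by
      intro j
      filter_upwards [hdist, hwlim, hkx, AEEqFun.coeFn_sub (v (φ j)) k] with x h1 h2 h3 h4
      have := dist_le_of_le_geometric_of_tendsto (1 / 2) |H x| (by norm_num) h1 h2 j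
      rw [h4, Pi.sub_apply, h3, ← Real.dist_eq]
      refine this.trans_eq ?_
      ring
    have hmem : ∀ j, v (φ j) - k ∈ (Z.power r).carrier := fun j =>
      (power_of_le_mul hZ hr hH (by positivity) (hle j)).1
    have hkm : k ∈ (Z.power r).carrier := by
      have := hsub (hv (φ 0)) (hmem 0)
      rwa [sub_sub_cancel] at this
    refine ⟨k, hkm, ?_⟩
    rw [Metric.tendsto_atTop]
    intro ε hε
    have hlim : Tendsto (fun j : ℕ => D⁻¹ * (1 / 4) ^ j
        + 2 * (1 / 2) ^ j * (Z.power r).qnorm H) atTop (𝓝 (D⁻¹ * 0 + 2 * 0 * (Z.power r).qnorm H)) :=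
      ((tendsto_pow_atTop_nhds_zero_of_lt_one (by norm_num) (by norm_num)).const_mul _).add
        (((tendsto_pow_atTop_nhds_zero_of_lt_one (by norm_num) (by norm_num)).const_mul _).mul_const
          _)
    simp only [mul_zero, zero_mul, add_zero] at hlim
    obtain ⟨j, hj⟩ := (hlim.eventually_lt_const hε).exists
    refine ⟨M j, fun n hn => ?_⟩
    rw [Real.dist_eq, sub_zero, abs_of_nonneg (renorm_qnorm_nonneg h0 _)]
    -- Compare v n with v (φ j) by the Cauchy property and v (φ j) with k by the regulator, for a
    -- single j making both bounds small.
    have h1 := renorm_qnorm_add_le h0 (hsub (hv n) (hv (φ j))) (hmem j)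
    rw [sub_add_sub_cancel] at h1
    have h2 := hM j n hn (φ j) (hφ j)
    have h3 := (renorm_qnorm_le h0 (hmem j)).trans
      (power_of_le_mul hZ hr hH (by positivity) (hle j)).2
    linarith
  · refine ⟨(power_of_le_mul hZ hr hf zero_le_one (g := g) (by simpa using h)).1,
      renorm_qnorm_mono h0 hf h⟩

end PowerRenorm

theorem exists_hasSumEstimate (hZ : Z.IsBanachFunctionSpace) {p : ℝ} (hp : 0 < p)
    (hconv : 1 < p → Z.IsConvex p) : ∃ D > 0, (Z.power (1 / p)).HasSumEstimate D ∧
      (p ≤ 1 ∨ Z.IsConvexWith p 1 → D = 1) := by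
  by_cases h1 : p ≤ 1
  · exact ⟨1, one_pos, power_hasSumEstimate_of_one_le hZ ((one_le_div₀ hp).2 h1), fun _ => rfl⟩
  -- Constant 1 is tried before the constant supplied by `hconv`, so that D = 1 in the isometric
  -- case.
  by_cases h2 : Z.IsConvexWith p 1
  · refine ⟨1, one_pos, ?_, fun _ => rfl⟩
    simpa using power_hasSumEstimate_of_isConvexWith hZ hp one_pos h2
  · obtain ⟨C, hC, h⟩ := hconv (not_le.1 h1)
    exact ⟨C ^ p, by positivity, power_hasSumEstimate_of_isConvexWith hZ hp hC h,
      fun h => (h.elim h1 h2).elim⟩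

/-- Substituting |f_j|^(1/p) into the q-concavity of Z and raising to the power p gives
q/p-concavity of the quasi-norm with constant C^p; passing to the equivalent norm costs the factor
D. -/
theorem power_renorm_isConcave (hZ : Z.IsBanachFunctionSpace) {p q D : ℝ} (hp : 0 < p)
    (hq : 0 < q) (hD : 0 < D) (hsum : (Z.power (1 / p)).HasSumEstimate D)
    (hconc : Z.IsConcave q) : (Z.power (1 / p)).renorm.IsConcave (q / p) := by
  obtain ⟨-, -, C, hC, h⟩ := hconc
  have hr : 0 < 1 / p := by positivity
  have h0 : ∀ f ∈ (Z.power (1 / p)).carrier, 0 ≤ (Z.power (1 / p)).qnorm f :=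
    fun f hf => power_qnorm_nonneg hZ hf
  have hY := power_renorm_isBanachFunctionSpace hZ hr hD hsum
  refine ⟨fun _ _ _ _ => rfl, fun _ _ _ => rfl, C ^ p * D, by positivity, fun n f hf => ?_⟩
  have hf' : ∀ j, absPow (1 / p) (f j) ∈ Z.carrier := hf
  have hl : lqSum (q / p) f ∈ (Z.power (1 / p)).carrier := hY.lqSum_mem (by positivity) hf
  have heq : lqSum q (fun j => absPow (1 / p) (f j)) = absPow (1 / p) (lqSum (q / p) f) := by
    refine AEEqFun.ext ?_
    filter_upwards [lqSum_ae q fun j => absPow (1 / p) (f j), lqSum_ae (q / p) f,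
      absPow_ae (1 / p) (lqSum (q / p) f), ae_all_iff.2 fun j => absPow_ae (1 / p) (f j)]
      with x h1 h2 h3 h4
    have h5 : 0 ≤ ∑ j, |f j x| ^ (q / p) := Finset.sum_nonneg fun _ _ => by positivity
    rw [h1, h3, h2, abs_of_nonneg (a := (∑ j, |f j x| ^ (q / p)) ^ (1 / (q / p))) (by positivity),
      ← Real.rpow_mul h5]
    have h6 : ∀ j, |absPow (1 / p) (f j) x| ^ q = |f j x| ^ (q / p) := by
      intro j
      rw [h4 j, abs_of_nonneg (Real.rpow_nonneg (abs_nonneg _) _),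
        ← Real.rpow_mul (abs_nonneg _)]
      congr 1; ring
    simp only [h6]
    congr 1
    field_simp
  have h1 := h n (fun j => absPow (1 / p) (f j)) hf'
  rw [heq] at h1
  simp only [id] at h1 ⊢
  have h2 : ∀ j, Z.qnorm (absPow (1 / p) (f j)) ^ q = (Z.power (1 / p)).qnorm (f j) ^ (q / p) := by
    intro j
    rw [← power_qnorm_rpow hZ hr (hf j), ← Real.rpow_mul (h0 _ (hf j))]
    congr 1; ring
  simp only [h2] at h1
  have hS : 0 ≤ ∑ j, (Z.power (1 / p)).qnorm (f j) ^ (q / p) :=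
    Finset.sum_nonneg fun j _ => Real.rpow_nonneg (h0 _ (hf j)) _
  calc (∑ j, (Z.power (1 / p)).renorm.qnorm (f j) ^ (q / p)) ^ (1 / (q / p))
      ≤ (∑ j, (Z.power (1 / p)).qnorm (f j) ^ (q / p)) ^ (1 / (q / p)) := by
        refine Real.rpow_le_rpow (Finset.sum_nonneg fun j _ =>
          Real.rpow_nonneg (renorm_qnorm_nonneg h0 _) _) (Finset.sum_le_sum fun j _ => ?_)
          (by positivity)
        exact Real.rpow_le_rpow (renorm_qnorm_nonneg h0 _) (renorm_qnorm_le h0 (hf j))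
          (by positivity)
    _ = ((∑ j, (Z.power (1 / p)).qnorm (f j) ^ (q / p)) ^ (1 / q)) ^ p := by
        rw [← Real.rpow_mul hS]
        congr 1
        field_simp
    _ ≤ (C * Z.qnorm (absPow (1 / p) (lqSum (q / p) f))) ^ p :=
        Real.rpow_le_rpow (by positivity) h1 hp.le
    _ = C ^ p * (Z.power (1 / p)).qnorm (lqSum (q / p) f) := by
        rw [Real.mul_rpow hC.le (hZ.norm_nonneg _ hl), ← power_qnorm_rpow hZ hr hl,
          ← Real.rpow_mul (h0 _ hl), one_div_mul_cancel hp.ne', Real.rpow_one]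
    _ ≤ C ^ p * (D * (Z.power (1 / p)).renorm.qnorm (lqSum (q / p) f)) :=
        mul_le_mul_of_nonneg_left (qnorm_le_mul_renorm_qnorm hD hsum hl) (by positivity)
    _ = _ := by ring

end FnSpace

/-! ### Restriction to measurable sets and order continuity -/

namespace FnSpace.IsBanachFunctionSpace

variable {Ω : Type*} {mΩ : MeasurableSpace Ω} {μ : Measure Ω} {X : FnSpace μ}

omit mΩ in
theorem abs_indicator_le_abs (A : Set Ω) (f : Ω → ℝ) (x : Ω) : |A.indicator f x| ≤ |f x| :=
  norm_indicator_le_norm_self f x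

theorem exists_restrict (hX : X.IsBanachFunctionSpace) {A : Set Ω} (hA : MeasurableSet A)
    (e : hX.Space) : ∃ a, ∀ᵐ x ∂μ, hX.incl a x = A.indicator (hX.incl e) x :=
  exists_of_le ((AEEqFun.aestronglyMeasurable (hX.incl e)).indicator hA) e
    (Eventually.of_forall fun x => abs_indicator_le_abs A _ x)

/-- The multiplication by the characteristic function of a measurable set. -/
def restrict (hX : X.IsBanachFunctionSpace) {A : Set Ω} (hA : MeasurableSet A) :
    hX.Space →L[ℝ] hX.Space :=
  LinearMap.mkContinuous
    { toFun := fun e => (hX.exists_restrict hA e).choose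
      map_add' := fun a b => ext_ae (by
        filter_upwards [(hX.exists_restrict hA a).choose_spec,
          (hX.exists_restrict hA b).choose_spec, (hX.exists_restrict hA (a + b)).choose_spec,
          hX.incl_add a b,
          hX.incl_add (hX.exists_restrict hA a).choose (hX.exists_restrict hA b).choose]
          with x h1 h2 h3 h4 h5
        rw [h5, h1, h2, h3]
        by_cases hx : x ∈ A
        · simpa only [indicator_of_mem hx] using h4
        · simp [hx])
      map_smul' := fun c a => ext_ae (by
        filter_upwards [(hX.exists_restrict hA a).choose_spec,
          (hX.exists_restrict hA (c • a)).choose_spec, hX.incl_smul c a,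
          hX.incl_smul c (hX.exists_restrict hA a).choose] with x h1 h2 h3 h4
        rw [RingHom.id_apply, h4, h1, h2]
        by_cases hx : x ∈ A
        · simpa only [indicator_of_mem hx] using h3
        · simp [hx]) } 1 (fun e => by
    rw [one_mul]
    refine norm_le_of_ae ?_
    filter_upwards [(hX.exists_restrict hA e).choose_spec] with x h1
    change |hX.incl (hX.exists_restrict hA e).choose x| ≤ _
    rw [h1]
    exact abs_indicator_le_abs A _ x)

variable {hX : X.IsBanachFunctionSpace}

theorem restrict_ae {A : Set Ω} (hA : MeasurableSet A) (e : hX.Space) :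
    ∀ᵐ x ∂μ, hX.incl (hX.restrict hA e) x = A.indicator (hX.incl e) x :=
  (hX.exists_restrict hA e).choose_spec

/-- For disjoint sets at most one term of the ℓ^s-sum is nonzero at each point, so this sum is
dominated by |e|, and concavity bounds the norms of the pieces. -/
theorem exists_bound_of_disjoint {s : ℝ} (hs : 0 < s) (hc : X.IsConcave s) :
    ∃ C > 0, ∀ (n : ℕ) (B : Fin n → Set Ω) (hB : ∀ j, MeasurableSet (B j)),
      Pairwise (fun i j => Disjoint (B i) (B j)) → ∀ e : hX.Space,
      (∑ j, ‖hX.restrict (hB j) e‖ ^ s) ^ (1 / s) ≤ C * ‖e‖ := by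
  obtain ⟨-, -, C, hC, h⟩ := hc
  refine ⟨C, hC, fun n B hB hd e => ?_⟩
  refine (h n (fun j => hX.incl (hX.restrict (hB j) e)) fun j => hX.incl_mem _).trans ?_
  refine mul_le_mul_of_nonneg_left ?_ hC.le
  refine (hX.ideal _ (hX.incl_mem e) _ ?_).2
  filter_upwards [lqSum_ae s fun j => hX.incl (hX.restrict (hB j) e),
    ae_all_iff.2 fun j => restrict_ae (hX := hX) (hB j) e] with x h1 h2
  have h3 : 0 ≤ ∑ j, |(B j).indicator (hX.incl e) x| ^ s :=
    Finset.sum_nonneg fun _ _ => by positivity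
  have h4 : ∑ j, |(B j).indicator (hX.incl e) x| ^ s ≤ |hX.incl e x| ^ s := by
    by_cases hx : ∃ i, x ∈ B i
    · obtain ⟨i, hi⟩ := hx
      rw [Finset.sum_eq_single i]
      · rw [indicator_of_mem hi]
      · intro j _ hj
        rw [indicator_of_notMem (disjoint_left.1 (hd hj.symm) hi), abs_zero,
          Real.zero_rpow hs.ne']
      · simp
    · refine le_trans (le_of_eq (Finset.sum_eq_zero fun j _ => ?_)) (by positivity)
      rw [indicator_of_notMem fun hj => hx ⟨j, hj⟩, abs_zero, Real.zero_rpow hs.ne']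
  rw [h1]
  simp only [h2]
  rw [abs_of_nonneg (Real.rpow_nonneg h3 _)]
  refine (Real.rpow_le_rpow h3 h4 (by positivity)).trans_eq ?_
  rw [← Real.rpow_mul (abs_nonneg _), mul_one_div_cancel hs.ne', Real.rpow_one]

/-- A concave Banach function space is order continuous. -/
theorem tendsto_restrict {s : ℝ} (hs : 0 < s) (hc : X.IsConcave s) (e : hX.Space)
    {A : ℕ → Set Ω} (hA : ∀ n, MeasurableSet (A n)) (hanti : Antitone A)
    (h0 : ∀ᵐ x ∂μ, hX.incl e x ≠ 0 → ∃ n, x ∉ A n) :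
    Tendsto (fun n => hX.restrict (hA n) e) atTop (𝓝 0) := by
  obtain ⟨C, hC, h⟩ := exists_bound_of_disjoint (hX := hX) hs hc
  have hcau : CauchySeq fun n => hX.restrict (hA n) e := by
    rw [Metric.cauchySeq_iff']
    by_contra hcon
    push Not at hcon
    obtain ⟨ε, hε, hcon⟩ := hcon
    choose F hF hFε using hcon
    let k : ℕ → ℕ := fun j => F^[j] 0
    have hk : ∀ j, k (j + 1) = F (k j) := fun j => Function.iterate_succ_apply' F j 0
    have hkm : Monotone k := monotone_nat_of_le_succ fun j => by rw [hk]; exact hF _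
    -- If the sequence were not Cauchy, the pieces of e on these disjoint differences would all have
    -- norm at least ε. Then n ε^s ≤ (C‖e‖)^s for every n, which is absurd.
    let B : ℕ → Set Ω := fun j => A (k j) \ A (k (j + 1))
    have hB : ∀ j, MeasurableSet (B j) := fun j => (hA _).diff (hA _)
    have hlt : ∀ i j, i < j → Disjoint (B i) (B j) := fun i j hij =>
      disjoint_left.2 fun x hx hx' => hx.2 (hanti (hkm hij) hx'.1)
    have hBε : ∀ j, ε ≤ ‖hX.restrict (hB j) e‖ := by
      intro j
      refine (hFε (k j)).trans ?_
      rw [dist_eq_norm]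
      refine norm_le_of_ae ?_
      filter_upwards [hX.incl_sub (hX.restrict (hA (F (k j))) e) (hX.restrict (hA (k j)) e),
        restrict_ae (hX := hX) (hA (F (k j))) e, restrict_ae (hX := hX) (hA (k j)) e,
        restrict_ae (hX := hX) (hB j) e] with x h1 h2 h3 h4
      rw [h1, h2, h3, h4]
      have hsub : A (F (k j)) ⊆ A (k j) := hanti (hF _)
      by_cases hx : x ∈ A (k j)
      · by_cases hx' : x ∈ A (F (k j))
        · simp [hx, hx']
        · have : x ∈ B j := ⟨hx, by rwa [hk]⟩
          simp [hx, hx', this]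
      · have hx' : x ∉ A (F (k j)) := fun h => hx (hsub h)
        simp [hx, hx']
    have hbd : ∀ n : ℕ, (n : ℝ) ≤ (C * ‖e‖ / ε) ^ s := by
      intro n
      have h1 := h n (fun j => B j) (fun j => hB j) (fun i j hij => by
        rcases lt_or_gt_of_ne hij with h | h
        · exact hlt i j h
        · exact (hlt j i h).symm) e
      have h2 : (n * ε ^ s) ^ (1 / s) ≤ C * ‖e‖ := by
        refine le_trans (Real.rpow_le_rpow (by positivity) ?_ (by positivity)) h1
        refine le_trans (by simp) (Finset.card_nsmul_le_sum Finset.univ _ (ε ^ s) fun j _ =>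
          Real.rpow_le_rpow hε.le (hBε j) hs.le)
      rw [Real.mul_rpow (by positivity) (by positivity), ← Real.rpow_mul hε.le,
        mul_one_div_cancel hs.ne', Real.rpow_one, ← le_div_iff₀ hε] at h2
      have h3 := Real.rpow_le_rpow (by positivity) h2 hs.le
      rwa [← Real.rpow_mul (by positivity), one_div_mul_cancel hs.ne', Real.rpow_one] at h3
    obtain ⟨n, hn⟩ := exists_nat_gt ((C * ‖e‖ / ε) ^ s)
    exact (hn.trans_le (hbd n)).false
  obtain ⟨g, hg⟩ := cauchySeq_tendsto_of_complete hcau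
  -- The limit g is identified as 0 through continuity of restrictions: it vanishes off each A n,
  -- and also where e does. The hypothesis `h0` says that these sets cover almost everything.
  have hgA : ∀ n, ∀ᵐ x ∂μ, x ∉ A n → hX.incl g x = 0 := by
    intro n
    have h1 : hX.restrict (hA n).compl g = 0 := by
      refine tendsto_nhds_unique (((hX.restrict (hA n).compl).continuous.tendsto g).comp hg) ?_
      refine tendsto_const_nhds.congr' ?_
      filter_upwards [eventually_ge_atTop n] with m hm
      refine ext_ae ?_
      filter_upwards [hX.incl_zero, restrict_ae (hX := hX) (hA m) e,
        restrict_ae (hX := hX) (hA n).compl (hX.restrict (hA m) e)] with x h1 h2 h3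
      rw [h1, Function.comp_apply, h3]
      by_cases hx : x ∈ A n
      · simp [hx]
      · have : x ∉ A m := fun h => hx (hanti hm h)
        simp [hx, h2, this]
    filter_upwards [restrict_ae (hX := hX) (hA n).compl g, hX.incl_zero] with x h2 h3 hx
    rw [h1, h3, indicator_of_mem (mem_compl hx)] at h2
    exact h2.symm
  have hge : ∀ᵐ x ∂μ, hX.incl e x = 0 → hX.incl g x = 0 := by
    let S : Set Ω := {x | hX.incl e x = 0}
    have hS : MeasurableSet S :=
      (AEEqFun.measurable (hX.incl e)) (measurableSet_singleton 0)
    have h1 : hX.restrict hS g = 0 := by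
      refine tendsto_nhds_unique (((hX.restrict hS).continuous.tendsto g).comp hg) ?_
      refine tendsto_const_nhds.congr fun m => ext_ae ?_
      filter_upwards [hX.incl_zero, restrict_ae (hX := hX) (hA m) e,
        restrict_ae (hX := hX) hS (hX.restrict (hA m) e)] with x h1 h2 h3
      rw [h1, Function.comp_apply, h3]
      by_cases hx : x ∈ S
      · have hx' : hX.incl e x = 0 := hx
        rw [indicator_of_mem hx, h2]
        by_cases hxm : x ∈ A m <;> simp [hxm, hx']
      · simp [hx]
    filter_upwards [restrict_ae (hX := hX) hS g, hX.incl_zero] with x h2 h3 hx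
    rw [h1, h3, indicator_of_mem (show x ∈ S from hx)] at h2
    exact h2.symm
  have : g = 0 := by
    refine ext_ae ?_
    filter_upwards [ae_all_iff.2 hgA, hge, h0, hX.incl_zero] with x h1 h2 h3 h4
    rw [h4]
    by_cases hx : hX.incl e x = 0
    · exact h2 hx
    · obtain ⟨n, hn⟩ := h3 hx
      exact h1 n hn
  rwa [this] at hg

end FnSpace.IsBanachFunctionSpace

/-! ### The δ-ring, the vector measure A ↦ χ_A, and density of simple functions -/

namespace FnSpace.IsBanachFunctionSpace

variable {Ω : Type*} {mΩ : MeasurableSpace Ω} {μ : Measure Ω} {X : FnSpace μ}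

theorem hasIndicator_iff (hX : X.IsBanachFunctionSpace) {A : Set Ω} :
    X.HasIndicator A ↔ ∃ e, ∀ᵐ x ∂μ, hX.incl e x = A.indicator (fun _ => (1 : ℝ)) x := by
  constructor
  · rintro ⟨f, hf, h⟩
    obtain ⟨e, rfl⟩ := hX.exists_incl_eq hf
    exact ⟨e, h⟩
  · rintro ⟨e, he⟩
    exact ⟨_, hX.incl_mem e, he⟩

theorem mem_indicatorSets_of_le (hX : X.IsBanachFunctionSpace) {A : Set Ω} (hA : MeasurableSet A)
    (e : hX.Space) (c : ℝ) (h : ∀ᵐ x ∂μ, x ∈ A → 1 ≤ c * |hX.incl e x|) :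
    A ∈ X.indicatorSets := by
  refine ⟨hA, hX.hasIndicator_iff.2 (exists_of_le_mul
    ((stronglyMeasurable_const.indicator hA).aestronglyMeasurable) e |c| ?_)⟩
  filter_upwards [h] with x hx
  by_cases hxA : x ∈ A
  · simpa [hxA] using (hx hxA).trans (mul_le_mul_of_nonneg_right (le_abs_self c) (abs_nonneg _))
  · simp only [hxA, not_false_eq_true, indicator_of_notMem, abs_zero]
    positivity

theorem mem_indicatorSets_of_subset (hX : X.IsBanachFunctionSpace) {A B : Set Ω}
    (hA : MeasurableSet A) (hB : B ∈ X.indicatorSets) (h : A ⊆ B) : A ∈ X.indicatorSets := by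
  obtain ⟨e, he⟩ := hX.hasIndicator_iff.1 hB.2
  refine hX.mem_indicatorSets_of_le hA e 1 ?_
  filter_upwards [he] with x hx hxA
  rw [hx, indicator_of_mem (h hxA)]
  simp

/-- The `δ`-ring of the measurable sets whose characteristic function is in the space. -/
def deltaRing (hX : X.IsBanachFunctionSpace) : DeltaRing Ω where
  sets := X.indicatorSets
  empty_mem := hX.mem_indicatorSets_of_le .empty 0 0 (by simp)
  union_mem A hA B hB := by
    obtain ⟨a, ha⟩ := hX.hasIndicator_iff.1 hA.2
    obtain ⟨b, hb⟩ := hX.hasIndicator_iff.1 hB.2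
    refine hX.mem_indicatorSets_of_le (hA.1.union hB.1) (a + b) 1 ?_
    filter_upwards [ha, hb, hX.incl_add a b] with x h1 h2 h3 hx
    rw [h3, h1, h2, one_mul]
    by_cases hxA : x ∈ A <;> by_cases hxB : x ∈ B
    · norm_num [hxA, hxB]
    · simp [hxA, hxB]
    · simp [hxA, hxB]
    · exact (hx.elim hxA hxB).elim
  diff_mem A hA B hB := hX.mem_indicatorSets_of_subset (hA.1.diff hB.1) hA sdiff_subset
  iInter_mem A hA := hX.mem_indicatorSets_of_subset (.iInter fun n => (hA n).1) (hA 0)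
    (iInter_subset A 0)

theorem measurableSet_of_mem (hX : X.IsBanachFunctionSpace) {A : Set Ω}
    (hA : A ∈ hX.deltaRing.sets) : MeasurableSet A := hA.1

theorem le_loc (hX : X.IsBanachFunctionSpace) : mΩ ≤ hX.deltaRing.loc := fun _ hA _ hB =>
  hX.mem_indicatorSets_of_subset (hA.inter hB.1) hB inter_subset_right

open Classical in
/-- The characteristic function of a set as an element of the space. -/
def indicatorElem (hX : X.IsBanachFunctionSpace) (A : Set Ω) : hX.Space :=
  if h : X.HasIndicator A then (hX.hasIndicator_iff.1 h).choose else 0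

theorem indicatorElem_ae (hX : X.IsBanachFunctionSpace) {A : Set Ω} (hA : A ∈ hX.deltaRing.sets) :
    ∀ᵐ x ∂μ, hX.incl (hX.indicatorElem A) x = A.indicator (fun _ => (1 : ℝ)) x := by
  have h : X.HasIndicator A := hA.2
  rw [indicatorElem, dif_pos h]
  exact (hX.hasIndicator_iff.1 h).choose_spec

/-- For any finite t containing `range N`, the error χ_U - ∑_{n ∈ t} χ_{A_n} is dominated by the
indicator of the tail of the union. Order continuity sends this tail to zero, and the summation is
unconditional because t is arbitrary beyond N. -/
theorem hasSum_indicatorElem (hX : X.IsBanachFunctionSpace) {s : ℝ} (hs : 0 < s)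
    (hc : X.IsConcave s) {A : ℕ → Set Ω} (hA : ∀ n, A n ∈ hX.deltaRing.sets)
    (hd : Pairwise fun i j => Disjoint (A i) (A j)) (hU : (⋃ n, A n) ∈ hX.deltaRing.sets) :
    HasSum (fun n => hX.indicatorElem (A n)) (hX.indicatorElem (⋃ n, A n)) := by
  let T : ℕ → Set Ω := fun N => ⋃ n ∈ Ici N, A n
  have hT : ∀ N, MeasurableSet (T N) := fun N =>
    .biUnion (to_countable _) fun n _ => hX.measurableSet_of_mem (hA n)
  have hT' : Antitone T := fun M N h => biUnion_subset_biUnion_left (Ici_subset_Ici.2 h)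
  have hlim := tendsto_restrict (hX := hX) hs hc (hX.indicatorElem (⋃ n, A n)) hT hT' (by
    refine Eventually.of_forall fun x _ => ?_
    by_cases hx : ∃ i, x ∈ A i
    · obtain ⟨i, hi⟩ := hx
      refine ⟨i + 1, fun h => ?_⟩
      obtain ⟨j, hj, hxj⟩ := mem_iUnion₂.1 h
      have : i ≠ j := by rintro rfl; exact absurd hj (by simp)
      exact disjoint_left.1 (hd this) hi hxj
    · refine ⟨0, fun h => ?_⟩
      obtain ⟨j, -, hxj⟩ := mem_iUnion₂.1 h
      exact hx ⟨j, hxj⟩)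
  rw [HasSum, SummationFilter.unconditional_filter, Metric.tendsto_atTop]
  intro ε hε
  obtain ⟨N, hN⟩ := Metric.tendsto_atTop.1 hlim ε hε
  refine ⟨Finset.range N, fun t ht => lt_of_le_of_lt ?_ (hN N le_rfl)⟩
  rw [dist_eq_norm, dist_zero_right]
  refine norm_le_of_ae ?_
  filter_upwards [hX.incl_sub (∑ n ∈ t, hX.indicatorElem (A n)) (hX.indicatorElem (⋃ n, A n)),
    hX.incl_sum t fun n => hX.indicatorElem (A n),
    ae_all_iff.2 fun n => hX.indicatorElem_ae (hA n), hX.indicatorElem_ae hU,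
    restrict_ae (hX := hX) (hT N) (hX.indicatorElem (⋃ n, A n))] with x h1 h2 h3 h4 h5
  rw [h1, h2, h5, h4]
  simp only [h3]
  by_cases hx : ∃ i, x ∈ A i
  · obtain ⟨i, hi⟩ := hx
    have hxU : x ∈ ⋃ n, A n := mem_iUnion.2 ⟨i, hi⟩
    have hne : ∀ j, j ≠ i → (A j).indicator (fun _ => (1 : ℝ)) x = 0 := fun j hj =>
      indicator_of_notMem (disjoint_left.1 (hd hj.symm) hi) _
    rw [indicator_of_mem hxU]
    by_cases hit : i ∈ t
    · rw [Finset.sum_eq_single i (fun j _ hj => hne j hj) (fun h => (h hit).elim),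
        indicator_of_mem hi]
      simp
    · have hiN : N ≤ i := by
        by_contra h
        exact hit (ht (Finset.mem_range.2 (not_le.1 h)))
      have hxT : x ∈ T N := mem_iUnion₂.2 ⟨i, hiN, hi⟩
      rw [Finset.sum_eq_zero fun j hj => hne j (by rintro rfl; exact hit hj),
        indicator_of_mem hxT, h4, indicator_of_mem hxU]
      simp
  · have hxU : x ∉ ⋃ n, A n := fun h => hx (mem_iUnion.1 h)
    rw [Finset.sum_eq_zero fun j _ => indicator_of_notMem (fun h => hx ⟨j, h⟩) _,
      indicator_of_notMem hxU]
    simp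

/-- The vector measure `A ↦ χ_A`. -/
def vectorMeasure (hX : X.IsBanachFunctionSpace) {s : ℝ} (hs : 0 < s) (hc : X.IsConcave s) :
    DeltaRingMeasure hX.deltaRing hX.Space where
  toFun := hX.indicatorElem
  hasSum' _ hA hd hU := hX.hasSum_indicatorElem hs hc hA hd hU

/-- The simple functions which are dominated by an element of the space are dense. -/
theorem exists_simpleFunc_tendsto (hX : X.IsBanachFunctionSpace) {s : ℝ} (hs : 0 < s)
    (hc : X.IsConcave s) (e : hX.Space) :
    ∃ (φ : ℕ → SimpleFunc Ω ℝ) (v : ℕ → hX.Space), (∀ n, ∀ᵐ x ∂μ, hX.incl (v n) x = φ n x) ∧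
      Tendsto v atTop (𝓝 e) := by
  have hf : Measurable (hX.incl e) := AEEqFun.measurable _
  set f : Ω → ℝ := ⇑(hX.incl e) with hfdef
  let φ : ℕ → SimpleFunc Ω ℝ := fun n => SimpleFunc.approxOn f hf univ 0 (mem_univ _) n
  have hφ : ∀ n x, |φ n x| ≤ 2 * |f x| := fun n x => by
    have := SimpleFunc.norm_approxOn_zero_le hf (mem_univ (0 : ℝ)) x n
    simp only [Real.norm_eq_abs] at this
    linarith
  have hlim : ∀ x, Tendsto (fun n => φ n x) atTop (𝓝 (f x)) := fun x =>
    SimpleFunc.tendsto_approxOn hf (mem_univ _) (by simp)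
  choose v hv using fun n => exists_of_le_mul (hX := hX)
    (φ n).stronglyMeasurable.aestronglyMeasurable e 2 (Eventually.of_forall (hφ n))
  refine ⟨φ, v, hv, ?_⟩
  rw [Metric.tendsto_atTop]
  intro ε hε
  obtain ⟨δ, hδ, hδε⟩ : ∃ δ > 0, δ * ‖e‖ < ε / 2 := by
    refine ⟨ε / (2 * (‖e‖ + 1)), by positivity, ?_⟩
    rw [div_mul_eq_mul_div, div_lt_div_iff₀ (by positivity) (by norm_num)]
    nlinarith [_root_.norm_nonneg e]
  -- Outside A n every later approximation has relative error at most δ. These sets decrease and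
  -- shrink to nothing where f ≠ 0, so order continuity applies to e restricted to them.
  let A : ℕ → Set Ω := fun n => ⋃ k ∈ Ici n, {x | δ * |f x| < |φ k x - f x|}
  have hA : ∀ n, MeasurableSet (A n) := fun n => .biUnion (to_countable _) fun k _ =>
    measurableSet_lt (measurable_const.mul hf.abs) ((φ k).measurable.sub hf).abs
  have hA' : Antitone A := fun m n h => biUnion_subset_biUnion_left (Ici_subset_Ici.2 h)
  have hAlim := tendsto_restrict (hX := hX) hs hc e hA hA' (by
    refine Eventually.of_forall fun x hx => ?_
    obtain ⟨N, hN⟩ := Metric.tendsto_atTop.1 (hlim x) (δ * |f x|)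
      (mul_pos hδ (abs_pos.2 hx))
    refine ⟨N, fun h => ?_⟩
    obtain ⟨k, hk, hxk⟩ := mem_iUnion₂.1 h
    exact (lt_asymm (hN k hk) hxk))
  -- On A n only |φ n - f| ≤ 3|f| is available; ε/6 makes this contribution less than ε/2.
  obtain ⟨N, hN⟩ := Metric.tendsto_atTop.1 hAlim (ε / 6) (by positivity)
  refine ⟨N, fun n hn => ?_⟩
  have hNn := hN n hn
  rw [dist_zero_right] at hNn
  obtain ⟨a, ha⟩ := exists_abs (hX.restrict (hA n) e)
  obtain ⟨b, hb⟩ := exists_abs e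
  have hna : ‖a‖ ≤ ‖hX.restrict (hA n) e‖ := norm_le_of_ae (by
    filter_upwards [ha] with x h; rw [h, abs_abs])
  have hnb : ‖b‖ ≤ ‖e‖ := norm_le_of_ae (by
    filter_upwards [hb] with x h; rw [h, abs_abs])
  have h1 : ‖v n - e‖ ≤ ‖δ • b + (3 : ℝ) • a‖ := by
    refine norm_le_of_ae ?_
    filter_upwards [hv n, hX.incl_sub (v n) e, hX.incl_add (δ • b) ((3 : ℝ) • a),
      hX.incl_smul δ b, hX.incl_smul 3 a, ha, hb, restrict_ae (hX := hX) (hA n) e]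
      with x h1 h2 h3 h4 h5 h6 h7 h8
    rw [h2, h1, h3, h4, h5, h6, h7, h8, ← hfdef]
    refine le_trans ?_ (le_abs_self _)
    by_cases hx : x ∈ A n
    · rw [indicator_of_mem hx]
      have := hφ n x
      have := abs_sub (φ n x) (f x)
      have : 0 ≤ δ * |f x| := by positivity
      linarith
    · rw [indicator_of_notMem hx, abs_zero, mul_zero, add_zero]
      by_contra h
      exact hx (mem_iUnion₂.2 ⟨n, mem_Ici.2 le_rfl, not_le.1 h⟩)
  have h2 : ‖δ • b + (3 : ℝ) • a‖ ≤ δ * ‖b‖ + 3 * ‖a‖ := by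
    refine (_root_.norm_add_le _ _).trans_eq ?_
    rw [_root_.norm_smul, _root_.norm_smul, Real.norm_of_nonneg hδ.le, Real.norm_of_nonneg
      (by norm_num)]
  have h3 : δ * ‖b‖ ≤ δ * ‖e‖ := mul_le_mul_of_nonneg_left hnb hδ.le
  rw [dist_eq_norm]
  linarith

end FnSpace.IsBanachFunctionSpace

/-! ### Variations and null sets of vector measures -/

theorem lintegral_enorm_simpleFunc {Ω : Type*} {mΩ : MeasurableSpace Ω} (φ : SimpleFunc Ω ℝ)
    (μ : Measure Ω) : ∫⁻ x, ‖φ x‖ₑ ∂μ = ∑ r ∈ φ.range, ‖r‖ₑ * μ (φ ⁻¹' {r}) := by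
  rw [← SimpleFunc.map_lintegral (fun r : ℝ => ‖r‖ₑ) φ, ← SimpleFunc.lintegral_eq_lintegral]
  rfl

namespace DeltaRingMeasure

variable {Ω : Type*} {R : DeltaRing Ω}

theorem variation_apply (ν : DeltaRingMeasure R ℝ) {A : Set Ω} (hA : MeasurableSet[R.loc] A) :
    ν.variation A = ν.variationFun A :=
  @Measure.ofMeasurable_apply Ω R.loc _ _ _ A hA

theorem variationFun_eq_zero_iff (ν : DeltaRingMeasure R ℝ) {A : Set Ω} :
    ν.variationFun A = 0 ↔ ∀ C ∈ R.sets, C ⊆ A → ν.toFun C = 0 := by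
  constructor
  · intro h C hC hCA
    have h1 := ν.le_variationFun (A := A) (l := [C]) ⟨by simp, by simpa using ⟨hC, hCA⟩⟩
    rw [h] at h1
    simpa using h1
  · intro h
    refine le_antisymm (iSup₂_le fun l hl => ?_) bot_le
    refine le_of_eq (List.sum_eq_zero fun x hx => ?_)
    obtain ⟨B, hB, rfl⟩ := List.mem_map.1 hx
    rw [h B (hl.2 B hB).1 (hl.2 B hB).2, enorm_zero]

theorem enorm_le_variationFun (ν : DeltaRingMeasure R ℝ) {A : Set Ω} (hA : A ∈ R.sets) :
    ‖ν.toFun A‖ₑ ≤ ν.variationFun A := by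
  simpa using ν.le_variationFun (A := A) (l := [A]) ⟨by simp, by simpa using hA⟩

variable {E : Type*} [NormedAddCommGroup E] [NormedSpace ℝ E]

theorem ae_variation_of_ae_control (m : DeltaRingMeasure R E) (x' : E →L[ℝ] ℝ) {P : Ω → Prop}
    (h : ∀ᵐ x ∂m.control, P x) : ∀ᵐ x ∂(m.dualComp x').variation, P x :=
  (Measure.absolutelyContinuous_of_le (Measure.le_sum _ x')).ae_le h

/-- A variation vanishes on D exactly when the scalar measure vanishes on all ring subsets of D, and
functionals separate the points of E. -/
theorem control_eq_zero_iff (m : DeltaRingMeasure R E) {D : Set Ω}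
    (hD : MeasurableSet[R.loc] D) : m.control D = 0 ↔ ∀ C ∈ R.sets, C ⊆ D → m.toFun C = 0 := by
  rw [control, Measure.sum_apply _ hD, ENNReal.tsum_eq_zero]
  simp only [variation_apply _ hD, variationFun_eq_zero_iff]
  exact ⟨fun h C hC hCD => SeparatingDual.eq_zero_of_forall_dual_eq_zero (R := ℝ)
    fun x' => h x' C hC hCD, fun h x' C hC hCD => by
      change x' (m.toFun C) = 0
      rw [h C hC hCD, map_zero]⟩

end DeltaRingMeasure

theorem RSimple.eval_indicator {Ω : Type*} {R : DeltaRing Ω} (φ : RSimple R) (A : Set Ω) (x : Ω) :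
    A.indicator φ.eval x
      = ∑ j, φ.coeff j * (φ.set j ∩ A).indicator (fun _ => (1 : ℝ)) x := by
  by_cases hx : x ∈ A
  · rw [indicator_of_mem hx, RSimple.eval]
    refine Finset.sum_congr rfl fun j _ => ?_
    by_cases hj : x ∈ φ.set j <;> simp [hx, hj]
  · rw [indicator_of_notMem hx, Finset.sum_eq_zero]
    intro j _
    simp [hx]

/-! ### Null sets, local measurability and simple functions for m(A) = χ_A -/

namespace FnSpace.IsBanachFunctionSpace

variable {Ω : Type*} {mΩ : MeasurableSpace Ω} {μ : Measure Ω} {X : FnSpace μ}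
  (hX : X.IsBanachFunctionSpace)

theorem indicatorElem_eq_zero_iff {C : Set Ω} (hC : C ∈ hX.deltaRing.sets) :
    hX.indicatorElem C = 0 ↔ μ C = 0 := by
  rw [measure_eq_zero_iff_ae_notMem]
  constructor
  · intro h
    filter_upwards [hX.indicatorElem_ae hC, hX.incl_zero] with x h1 h2 hx
    rw [h, h2, indicator_of_mem hx] at h1
    exact zero_ne_one h1
  · intro h
    refine ext_ae ?_
    filter_upwards [hX.indicatorElem_ae hC, hX.incl_zero, h] with x h1 h2 h3
    rw [h1, h2, indicator_of_notMem h3]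

theorem inter_mem_of_loc {A C : Set Ω} (hA : MeasurableSet[hX.deltaRing.loc] A)
    (hC : C ∈ hX.deltaRing.sets) : C ∩ A ∈ hX.deltaRing.sets := by
  rw [inter_comm]; exact hA C hC

/-- An element of the space vanishes on a set all of whose subsets in the `δ`-ring are null. -/
theorem ae_eq_zero_of_forall_null {S : Set Ω} (hS : MeasurableSet S)
    (h : ∀ C ∈ X.indicatorSets, C ⊆ S → μ C = 0) (e : hX.Space) :
    ∀ᵐ x ∂μ, x ∈ S → hX.incl e x = 0 := by
  -- On C n the element e is bounded away from zero, so C n belongs to the ring; these sets exhaust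
  -- the part of S where e ≠ 0.
  let C : ℕ → Set Ω := fun n => S ∩ {x | 1 ≤ (n + 1) * |hX.incl e x|}
  have hC : ∀ n, MeasurableSet (C n) := fun n => hS.inter
    (measurableSet_le measurable_const (measurable_const.mul (AEEqFun.measurable _).abs))
  have hC0 : ∀ n, μ (C n) = 0 := fun n => h _ (hX.mem_indicatorSets_of_le (hC n) e (n + 1)
    (Eventually.of_forall fun x hx => hx.2)) inter_subset_left
  filter_upwards [ae_all_iff.2 fun n => measure_eq_zero_iff_ae_notMem.1 (hC0 n)] with x hx hxS
  by_contra h0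
  obtain ⟨n, hn⟩ := exists_nat_gt (|hX.incl e x|⁻¹)
  refine hx n ⟨hxS, ?_⟩
  have h1 : 0 < |hX.incl e x| := abs_pos.2 h0
  have h2 := mul_le_mul_of_nonneg_right hn.le h1.le
  rw [inv_mul_cancel₀ h1.ne'] at h2
  change 1 ≤ ((n : ℝ) + 1) * |hX.incl e x|
  linarith

/-- A set of R^loc meets each C n in a member of the ring, hence in a set of Σ; countably many such
traces can be glued. -/
theorem measurable_indicator_of_loc {g : Ω → ℝ} (hg : Measurable[hX.deltaRing.loc] g)
    {C : ℕ → Set Ω} (hC : ∀ n, C n ∈ hX.deltaRing.sets) :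
    Measurable ((⋃ n, C n).indicator g) := by
  intro B hB
  rw [indicator_preimage, Set.ite, inter_iUnion]
  refine (MeasurableSet.iUnion fun n => hX.measurableSet_of_mem (hg hB _ (hC n))).union
    ((measurable_const hB).diff (.iUnion fun n => hX.measurableSet_of_mem (hC n)))

theorem simpleFunc_fiber_mem {φ : SimpleFunc Ω ℝ} {v : hX.Space}
    (hv : ∀ᵐ x ∂μ, hX.incl v x = φ x) {r : ℝ} (hr : r ≠ 0) :
    φ ⁻¹' {r} ∈ hX.deltaRing.sets := by
  refine hX.mem_indicatorSets_of_le (φ.measurableSet_fiber r) v |r|⁻¹ ?_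
  filter_upwards [hv] with x h hx
  rw [h, show φ x = r from hx, inv_mul_cancel₀ (abs_ne_zero.2 hr)]

omit mΩ in
theorem sum_mul_indicator_fiber [MeasurableSpace Ω] (φ : SimpleFunc Ω ℝ) (x : Ω) :
    ∑ r ∈ φ.range with r ≠ 0, r * (φ ⁻¹' {r}).indicator (fun _ => (1 : ℝ)) x = φ x := by
  by_cases hx : φ x = 0
  · rw [hx]
    refine Finset.sum_eq_zero fun r hr => ?_
    rw [indicator_of_notMem, mul_zero]
    rintro h
    exact (Finset.mem_filter.1 hr).2 (h.symm.trans hx)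
  · rw [Finset.sum_eq_single (φ x)]
    · simp
    · intro r _ hr
      rw [indicator_of_notMem, mul_zero]
      rintro h
      exact hr h.symm
    · intro h
      exact (h (Finset.mem_filter.2 ⟨SimpleFunc.mem_range_self _ _, hx⟩)).elim

theorem simpleFunc_eq_sum {φ : SimpleFunc Ω ℝ} {v : hX.Space}
    (hv : ∀ᵐ x ∂μ, hX.incl v x = φ x) :
    v = ∑ r ∈ φ.range with r ≠ 0, r • hX.indicatorElem (φ ⁻¹' {r}) := by
  refine ext_ae ?_
  have h : ∀ᵐ x ∂μ, ∀ r ∈ (φ.range.filter (· ≠ 0)),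
      hX.incl (r • hX.indicatorElem (φ ⁻¹' {r})) x
        = r * (φ ⁻¹' {r}).indicator (fun _ => (1 : ℝ)) x := by
    rw [eventually_all_finset]
    intro r hr
    filter_upwards [hX.incl_smul r (hX.indicatorElem (φ ⁻¹' {r})),
      hX.indicatorElem_ae (hX.simpleFunc_fiber_mem hv (Finset.mem_filter.1 hr).2)] with x h1 h2
    rw [h1, h2]
  filter_upwards [hv, h, hX.incl_sum (φ.range.filter (· ≠ 0))
    fun r => r • hX.indicatorElem (φ ⁻¹' {r})] with x h1 h2 h3
  rw [h1, h3, Finset.sum_congr rfl h2, sum_mul_indicator_fiber]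

theorem exists_rSimple {φ : SimpleFunc Ω ℝ} {v : hX.Space}
    (hv : ∀ᵐ x ∂μ, hX.incl v x = φ x) :
    ∃ ψ : RSimple hX.deltaRing, ∀ x, ψ.eval x = φ x := by
  let T := φ.range.filter (· ≠ 0)
  refine ⟨⟨T.card, fun j => T.equivFin.symm j, fun j => φ ⁻¹' {(T.equivFin.symm j : ℝ)},
    fun j => hX.simpleFunc_fiber_mem hv (Finset.mem_filter.1 (T.equivFin.symm j).2).2⟩,
    fun x => ?_⟩
  rw [← sum_mul_indicator_fiber φ x]
  exact (Fintype.sum_equiv T.equivFin.symm _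
    (fun r : T => (r : ℝ) * (φ ⁻¹' {(r : ℝ)}).indicator (fun _ => (1 : ℝ)) x) fun _ => rfl).trans
    (Finset.sum_coe_sort T fun r => r * (φ ⁻¹' {r}).indicator (fun _ => (1 : ℝ)) x)

/-- The integral of an `R`-simple function with respect to the vector measure `A ↦ χ_A`. -/
def simpleElem (ψ : RSimple hX.deltaRing) (A : Set Ω) : hX.Space :=
  ∑ j, ψ.coeff j • hX.indicatorElem (ψ.set j ∩ A)

theorem simpleElem_ae (ψ : RSimple hX.deltaRing) {A : Set Ω}
    (hA : MeasurableSet[hX.deltaRing.loc] A) :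
    ∀ᵐ x ∂μ, hX.incl (hX.simpleElem ψ A) x = A.indicator ψ.eval x := by
  have h : ∀ᵐ x ∂μ, ∀ j, hX.incl (ψ.coeff j • hX.indicatorElem (ψ.set j ∩ A)) x
      = ψ.coeff j * (ψ.set j ∩ A).indicator (fun _ => (1 : ℝ)) x := by
    refine ae_all_iff.2 fun j => ?_
    filter_upwards [hX.incl_smul (ψ.coeff j) (hX.indicatorElem (ψ.set j ∩ A)),
      hX.indicatorElem_ae (hX.inter_mem_of_loc hA (ψ.set_mem j))] with x h1 h2
    rw [h1, h2]
  filter_upwards [h, hX.incl_sum Finset.univ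
    fun j => ψ.coeff j • hX.indicatorElem (ψ.set j ∩ A)] with x h1 h2
  rw [simpleElem, h2, ψ.eval_indicator]
  exact Finset.sum_congr rfl fun j _ => h1 j

theorem simpleElem_univ_ae (ψ : RSimple hX.deltaRing) :
    ∀ᵐ x ∂μ, hX.incl (hX.simpleElem ψ univ) x = ψ.eval x := by
  simpa using hX.simpleElem_ae ψ (A := univ) .univ

theorem measurable_eval (ψ : RSimple hX.deltaRing) : Measurable ψ.eval := by
  unfold RSimple.eval
  exact Finset.measurable_sum _ fun j _ => measurable_const.mul
    (measurable_const.indicator (hX.measurableSet_of_mem (ψ.set_mem j)))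

/-! ### Integrals against |x*m| compared with x* -/

section DualBound

variable (x' : hX.Space →L[ℝ] ℝ)

/-- The supremum of `|x*(h)|` over the elements `h` with `|h| ≤ k`. -/
def dualBound (k : Ω → ℝ) : ℝ≥0∞ :=
  ⨆ (h : hX.Space) (_ : ∀ᵐ x ∂μ, |hX.incl h x| ≤ k x), ‖x' h‖ₑ

/-- After sign changes the two values of x* are nonnegative and add up on a' + b'. Only this
superadditive half of the Riesz–Kantorovich formula is needed. -/
theorem dualBound_add_le {k l : Ω → ℝ} (hk : ∀ x, 0 ≤ k x) (hl : ∀ x, 0 ≤ l x) :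
    hX.dualBound x' k + hX.dualBound x' l ≤ hX.dualBound x' (fun x => k x + l x) := by
  have hz : ∀ k : Ω → ℝ, (∀ x, 0 ≤ k x) → ∃ h : hX.Space, ∀ᵐ x ∂μ, |hX.incl h x| ≤ k x := by
    intro k hk
    refine ⟨0, ?_⟩
    filter_upwards [hX.incl_zero] with x h
    rw [h, abs_zero]
    exact hk x
  have hpos : ∀ (k : Ω → ℝ) (h : hX.Space), (∀ᵐ x ∂μ, |hX.incl h x| ≤ k x) →
      ∃ h' : hX.Space, (∀ᵐ x ∂μ, |hX.incl h' x| ≤ k x) ∧ ‖x' h‖ₑ = ENNReal.ofReal (x' h') ∧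
        0 ≤ x' h' := by
    intro k h hk
    rcases le_total 0 (x' h) with h0 | h0
    · exact ⟨h, hk, by rw [Real.enorm_eq_ofReal h0], h0⟩
    · refine ⟨(-1 : ℝ) • h, ?_, ?_, by simpa using h0⟩
      · filter_upwards [hk, hX.incl_smul (-1) h] with x h1 h2
        rw [h2]; simpa using h1
      · rw [← enorm_neg, Real.enorm_eq_ofReal (by simpa using h0)]
        simp
  refine ENNReal.biSup_add_biSup_le' (hz k hk) (hz l hl) fun a ha b hb => ?_
  obtain ⟨a', ha', hea, ha0⟩ := hpos k a ha
  obtain ⟨b', hb', heb, hb0⟩ := hpos l b hb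
  rw [hea, heb, ← ENNReal.ofReal_add ha0 hb0, ← map_add, ← Real.enorm_eq_ofReal (by
    rw [map_add]; positivity)]
  refine le_iSup₂ (f := fun (h : hX.Space)
    (_ : ∀ᵐ x ∂μ, |hX.incl h x| ≤ k x + l x) => ‖x' h‖ₑ) (a' + b') ?_
  filter_upwards [ha', hb', hX.incl_add a' b'] with x h1 h2 h3
  rw [h3]
  exact (abs_add_le _ _).trans (add_le_add h1 h2)

variable {s : ℝ} (hs : 0 < s) (hc : X.IsConcave s)

/-- Take h = ∑ ±χ_B with signs making each x*(±χ_B) nonnegative; disjointness keeps |h| ≤ χ_A. The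
induction removes the head B from A. -/
theorem exists_of_isPartialPartition (l : List (Set Ω)) : ∀ A : Set Ω,
    DeltaRingMeasure.IsPartialPartition hX.deltaRing A l →
    ∃ h : hX.Space, (∀ᵐ x ∂μ, |hX.incl h x| ≤ A.indicator (fun _ => (1 : ℝ)) x) ∧
      (l.map fun B => ‖x' (hX.indicatorElem B)‖ₑ).sum = ENNReal.ofReal (x' h) ∧ 0 ≤ x' h := by
  induction l with
  | nil =>
    intro A _
    refine ⟨0, ?_, by simp, by simp⟩
    filter_upwards [hX.incl_zero] with x h
    rw [h, abs_zero]
    exact indicator_nonneg (fun _ _ => zero_le_one) x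
  | cons B l ih =>
    intro A hl
    have hB := hl.2 B List.mem_cons_self
    obtain ⟨h, hh, hsum, h0⟩ := ih (A \ B) ⟨(List.pairwise_cons.1 hl.1).2, fun C hC =>
      ⟨(hl.2 C (List.mem_cons_of_mem _ hC)).1, subset_sdiff.2
        ⟨(hl.2 C (List.mem_cons_of_mem _ hC)).2, ((List.pairwise_cons.1 hl.1).1 C hC).symm⟩⟩⟩
    obtain ⟨c, hc, hcx⟩ : ∃ c : ℝ, |c| = 1 ∧ c * x' (hX.indicatorElem B)
        = |x' (hX.indicatorElem B)| := by
      rcases le_total 0 (x' (hX.indicatorElem B)) with h | h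
      · exact ⟨1, by simp, by rw [abs_of_nonneg h, one_mul]⟩
      · exact ⟨-1, by simp, by rw [abs_of_nonpos h, neg_one_mul]⟩
    have hx' : x' (h + c • hX.indicatorElem B) = x' h + |x' (hX.indicatorElem B)| := by
      rw [map_add, map_smul, smul_eq_mul, hcx]
    refine ⟨h + c • hX.indicatorElem B, ?_, ?_, by rw [hx']; positivity⟩
    · filter_upwards [hh, hX.incl_add h (c • hX.indicatorElem B),
        hX.incl_smul c (hX.indicatorElem B), hX.indicatorElem_ae hB.1] with x h1 h2 h3 h4
      rw [h2, h3, h4]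
      refine (abs_add_le _ _).trans ((add_le_add_left h1 _).trans ?_)
      rw [abs_mul, hc, one_mul]
      by_cases hxB : x ∈ B
      · simp [hxB, hB.2 hxB]
      · by_cases hxA : x ∈ A <;> simp [hxB, hxA]
    · rw [List.map_cons, List.sum_cons, hsum, hx', ENNReal.ofReal_add h0 (abs_nonneg _),
        add_comm, ← Real.enorm_eq_ofReal_abs]

theorem mul_variationFun_le_dualBound (r : NNReal) (A : Set Ω) :
    r * ((hX.vectorMeasure hs hc).dualComp x').variationFun A
      ≤ hX.dualBound x' (fun x => r * A.indicator (fun _ => (1 : ℝ)) x) := by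
  rw [DeltaRingMeasure.variationFun, ENNReal.mul_iSup]
  refine iSup_le fun l => ?_
  rw [ENNReal.mul_iSup]
  refine iSup_le fun hl => ?_
  obtain ⟨h, hh, hsum, h0⟩ := hX.exists_of_isPartialPartition x' l A hl
  change r * (l.map fun B => ‖x' (hX.indicatorElem B)‖ₑ).sum ≤ _
  have e1 : (r : ℝ≥0∞) * ENNReal.ofReal (x' h) = ‖x' ((r : ℝ) • h)‖ₑ := by
    rw [map_smul, smul_eq_mul, enorm_mul, Real.enorm_eq_ofReal h0,
      Real.enorm_eq_ofReal r.coe_nonneg, ENNReal.ofReal_coe_nnreal]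
  rw [hsum, e1]
  refine le_iSup₂ (f := fun (h : hX.Space)
    (_ : ∀ᵐ x ∂μ, |hX.incl h x| ≤ r * A.indicator (fun _ => (1 : ℝ)) x) => ‖x' h‖ₑ) _ ?_
  filter_upwards [hh, hX.incl_smul r h] with x h1 h2
  rw [h2, abs_mul, abs_of_nonneg r.coe_nonneg]
  exact mul_le_mul_of_nonneg_left h1 r.coe_nonneg

theorem sum_variationFun_le_dualBound (t : Finset NNReal) (A : NNReal → Set Ω) :
    ∑ r ∈ t, r * ((hX.vectorMeasure hs hc).dualComp x').variationFun (A r)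
      ≤ hX.dualBound x' (fun x => ∑ r ∈ t, r * (A r).indicator (fun _ => (1 : ℝ)) x) := by
  have hnn : ∀ (r : NNReal) x, 0 ≤ (r : ℝ) * (A r).indicator (fun _ => (1 : ℝ)) x := fun r x =>
    mul_nonneg r.coe_nonneg (indicator_nonneg (fun _ _ => zero_le_one) x)
  induction t using Finset.induction_on with
  | empty => simp
  | insert r t hr ih =>
    simp only [Finset.sum_insert hr]
    refine (add_le_add (hX.mul_variationFun_le_dualBound x' hs hc r (A r)) ih).trans ?_
    exact hX.dualBound_add_le x' (hnn r) fun x => Finset.sum_nonneg fun r _ => hnn r x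

/-- `∫ |f| d|x* m| ≤ ‖x*‖ ‖f‖`. -/
theorem lintegral_variation_le {f : Ω → ℝ} {e : hX.Space}
    (h : ∀ᵐ x ∂μ, |f x| ≤ |hX.incl e x|) :
    ∫⁻ x, ‖f x‖ₑ ∂((hX.vectorMeasure hs hc).dualComp x').variation ≤ ‖x'‖ₑ * ‖e‖ₑ := by
  rw [lintegral_eq_nnreal]
  refine iSup₂_le fun φ hφ => ?_
  rw [SimpleFunc.map_lintegral]
  have e1 : ∀ r, ((hX.vectorMeasure hs hc).dualComp x').variation (φ ⁻¹' {r})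
      = ((hX.vectorMeasure hs hc).dualComp x').variationFun (φ ⁻¹' {r}) := fun r =>
    DeltaRingMeasure.variation_apply _
      (@SimpleFunc.measurableSet_fiber _ _ hX.deltaRing.loc φ r)
  simp only [e1]
  -- The level sets of φ are only known to lie in R^loc, so φ need not define an element of X. Its
  -- integral is therefore controlled by the elements k of X with |k| ≤ φ, and these satisfy ‖k‖ ≤
  -- ‖e‖.
  refine (hX.sum_variationFun_le_dualBound x' hs hc _ _).trans (iSup₂_le fun k hk => ?_)
  have hke : ‖k‖ ≤ ‖e‖ := by
    refine norm_le_of_ae ?_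
    filter_upwards [h, hk] with x h1 h2
    refine (h2.trans ?_).trans h1
    have h3 : ∑ r ∈ @SimpleFunc.range _ _ hX.deltaRing.loc φ,
        (r : ℝ) * (φ ⁻¹' {r}).indicator (fun _ => (1 : ℝ)) x = φ x := by
      rw [Finset.sum_eq_single (φ x)]
      · simp
      · intro r _ hr
        rw [indicator_of_notMem, mul_zero]
        exact fun h => hr h.symm
      · intro h
        exact (h (@SimpleFunc.mem_range_self _ _ hX.deltaRing.loc φ x)).elim
    rw [h3]
    have h4 := hφ x
    rw [← ofReal_norm, ← ENNReal.ofReal_coe_nnreal,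
      ENNReal.ofReal_le_ofReal_iff (_root_.norm_nonneg _)] at h4
    exact h4
  calc ‖x' k‖ₑ ≤ ‖x'‖ₑ * ‖k‖ₑ := x'.le_opENorm k
    _ ≤ ‖x'‖ₑ * ‖e‖ₑ := by
        gcongr
        exact enorm_le_iff_norm_le.2 hke

/-- Expand v over its nonzero level sets, which belong to the ring, and use |x*(m(A))| ≤ |x*m|(A).
The zero level is dropped because it may lie outside the ring. -/
theorem enorm_le_lintegral_simpleFunc {φ : SimpleFunc Ω ℝ} {v : hX.Space}
    (hv : ∀ᵐ x ∂μ, hX.incl v x = φ x) :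
    ‖x' v‖ₑ ≤ ∫⁻ x, ‖φ x‖ₑ ∂((hX.vectorMeasure hs hc).dualComp x').variation := by
  let φ' : @SimpleFunc Ω hX.deltaRing.loc ℝ :=
    @SimpleFunc.mk Ω hX.deltaRing.loc ℝ φ (fun r => hX.le_loc _ (φ.measurableSet_fiber r))
      φ.finite_range
  have h1 : ∫⁻ x, ‖φ x‖ₑ ∂((hX.vectorMeasure hs hc).dualComp x').variation
      = ∑ r ∈ φ.range, ‖r‖ₑ *
        ((hX.vectorMeasure hs hc).dualComp x').variation (φ ⁻¹' {r}) := by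
    exact lintegral_enorm_simpleFunc φ' _
  rw [h1]
  nth_rewrite 1 [hX.simpleFunc_eq_sum hv]
  rw [map_sum]
  refine (enorm_sum_le _ _).trans ?_
  refine (Finset.sum_le_sum fun r hr => ?_).trans
    (Finset.sum_le_sum_of_subset (Finset.filter_subset _ _))
  rw [map_smul, smul_eq_mul, enorm_mul]
  refine mul_le_mul_right ?_ _
  rw [DeltaRingMeasure.variation_apply _ (hX.le_loc _ (φ.measurableSet_fiber r))]
  exact ((hX.vectorMeasure hs hc).dualComp x').enorm_le_variationFun
    (hX.simpleFunc_fiber_mem hv (Finset.mem_filter.1 hr).2)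

/-- `|x*(f)| ≤ ∫ |f| d|x* m|`. -/
theorem enorm_le_lintegral_variation {f : Ω → ℝ} (hf : Measurable f) {e : hX.Space}
    (he : ∀ᵐ x ∂μ, hX.incl e x = f x) :
    ‖x' e‖ₑ ≤ ∫⁻ x, ‖f x‖ₑ ∂((hX.vectorMeasure hs hc).dualComp x').variation := by
  obtain ⟨φ, v, hv, hlim⟩ := hX.exists_simpleFunc_tendsto hs hc e
  -- The inequality for simple functions passes to e because the upper bound for the integral makes
  -- the error at most ‖x*‖‖v n - e‖.
  have h1 : ∀ n, ‖x' (v n)‖ₑ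
      ≤ ∫⁻ x, ‖f x‖ₑ ∂((hX.vectorMeasure hs hc).dualComp x').variation + ‖x'‖ₑ * ‖v n - e‖ₑ := by
    intro n
    have h2 : ∀ᵐ x ∂μ, |φ n x - f x| ≤ |hX.incl (v n - e) x| := by
      filter_upwards [hv n, he, hX.incl_sub (v n) e] with x h1 h2 h3
      rw [h3, h1, h2]
    calc ‖x' (v n)‖ₑ ≤ ∫⁻ x, ‖φ n x‖ₑ ∂((hX.vectorMeasure hs hc).dualComp x').variation :=
          hX.enorm_le_lintegral_simpleFunc x' hs hc (hv n)
      _ ≤ ∫⁻ x, (‖f x‖ₑ + ‖φ n x - f x‖ₑ)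
            ∂((hX.vectorMeasure hs hc).dualComp x').variation := by
          refine lintegral_mono fun x => ?_
          simpa using enorm_add_le (f x) (φ n x - f x)
      _ = ∫⁻ x, ‖f x‖ₑ ∂((hX.vectorMeasure hs hc).dualComp x').variation
            + ∫⁻ x, ‖φ n x - f x‖ₑ ∂((hX.vectorMeasure hs hc).dualComp x').variation :=
          lintegral_add_left (hf.enorm.mono hX.le_loc le_rfl) _
      _ ≤ _ := by
          gcongr
          exact hX.lintegral_variation_le x' hs hc h2
  have hl : Tendsto (fun n => ‖x' (v n)‖ₑ) atTop (𝓝 ‖x' e‖ₑ) :=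
    (continuous_enorm.tendsto _).comp ((x'.continuous.tendsto e).comp hlim)
  have hr : Tendsto (fun n =>
      ∫⁻ x, ‖f x‖ₑ ∂((hX.vectorMeasure hs hc).dualComp x').variation + ‖x'‖ₑ * ‖v n - e‖ₑ) atTop
      (𝓝 (∫⁻ x, ‖f x‖ₑ ∂((hX.vectorMeasure hs hc).dualComp x').variation + ‖x'‖ₑ * 0)) := by
    refine tendsto_const_nhds.add (ENNReal.Tendsto.const_mul ?_ (Or.inr enorm_ne_top))
    have := (continuous_enorm.tendsto _).comp (hlim.sub_const e)
    simpa [Function.comp_def] using this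
  simpa using le_of_tendsto_of_tendsto' hl hr h1

end DualBound

end FnSpace.IsBanachFunctionSpace

/-! ### Transport of classes along a change of σ-algebra and measure -/

namespace L0

variable {Ω : Type*} {mΩ : MeasurableSpace Ω} {μ : Measure Ω}

theorem add_ae (f g : L0 μ) : ∀ᵐ x ∂μ, (f + g : L0 μ) x = f x + g x := AEEqFun.coeFn_add f g

theorem smul_ae (c : ℝ) (f : L0 μ) : ∀ᵐ x ∂μ, (c • f : L0 μ) x = c * f x :=
  AEEqFun.coeFn_smul c f

theorem measurable (f : L0 μ) : Measurable f := AEEqFun.measurable f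

end L0

section ChangeClass

variable {Ω : Type*} {m₁ m₂ : MeasurableSpace Ω} {μ : @Measure Ω m₁} {ν : @Measure Ω m₂}

theorem changeClass_ae (h : m₁ ≤ m₂) (f : L0 μ) : ∀ᵐ x ∂ν, changeClass h μ ν f x = f x :=
  AEEqFun.coeFn_mk _ _

theorem changeClass_eq_iff (h : m₁ ≤ m₂) {f : L0 μ} {g : L0 ν} :
    changeClass h μ ν f = g ↔ ∀ᵐ x ∂ν, f x = g x := by
  constructor
  · rintro rfl
    filter_upwards [changeClass_ae (ν := ν) h f] with x hx using hx.symm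
  · intro hfg
    refine AEEqFun.ext ?_
    filter_upwards [changeClass_ae (ν := ν) h f, hfg] with x h1 h2
    rw [h1, h2]

theorem ae_of_ae_of_null (hμν : ∀ s : Set Ω, μ s = 0 → ν s = 0) {P : Ω → Prop}
    (h : ∀ᵐ x ∂μ, P x) : ∀ᵐ x ∂ν, P x :=
  hμν _ h

theorem changeClass_absPow (h : m₁ ≤ m₂) (hμν : ∀ s : Set Ω, μ s = 0 → ν s = 0) (p : ℝ)
    (f : L0 μ) : changeClass h μ ν (absPow p f) = absPow p (changeClass h μ ν f) := by
  rw [changeClass_eq_iff]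
  filter_upwards [ae_of_ae_of_null hμν (absPow_ae p f), absPow_ae p (changeClass h μ ν f),
    changeClass_ae (ν := ν) h f] with x h1 h2 h3
  rw [h1, h2, h3]

theorem changeClass_lqSum (h : m₁ ≤ m₂) (hμν : ∀ s : Set Ω, μ s = 0 → ν s = 0) (q : ℝ) {n : ℕ}
    (f : Fin n → L0 μ) :
    changeClass h μ ν (lqSum q f) = lqSum q fun j => changeClass h μ ν (f j) := by
  rw [changeClass_eq_iff]
  filter_upwards [ae_of_ae_of_null hμν (lqSum_ae q f), lqSum_ae q fun j => changeClass h μ ν (f j),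
    ae_all_iff.2 fun j => changeClass_ae (ν := ν) h (f j)] with x h1 h2 h3
  rw [h1, h2]
  simp only [h3]

theorem changeClass_add (h : m₁ ≤ m₂) (hμν : ∀ s : Set Ω, μ s = 0 → ν s = 0) (f g : L0 μ) :
    changeClass h μ ν (f + g) = changeClass h μ ν f + changeClass h μ ν g := by
  rw [changeClass_eq_iff]
  filter_upwards [ae_of_ae_of_null hμν (L0.add_ae f g),
    L0.add_ae (changeClass h μ ν f) (changeClass h μ ν g),
    changeClass_ae (ν := ν) h f, changeClass_ae (ν := ν) h g] with x h1 h2 h3 h4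
  rw [h1, h2, h3, h4]

theorem changeClass_smul (h : m₁ ≤ m₂) (hμν : ∀ s : Set Ω, μ s = 0 → ν s = 0) (c : ℝ)
    (f : L0 μ) : changeClass h μ ν (c • f) = c • changeClass h μ ν f := by
  rw [changeClass_eq_iff]
  filter_upwards [ae_of_ae_of_null hμν (L0.smul_ae c f),
    L0.smul_ae c (changeClass h μ ν f), changeClass_ae (ν := ν) h f] with x h1 h2 h3
  rw [h1, h2, h3]

end ChangeClass

/-! ### A concave space X is L¹(m), with I_m the identity -/

namespace FnSpace.IsBanachFunctionSpace

variable {Ω : Type*} {mΩ : MeasurableSpace Ω} {μ : Measure Ω} {X : FnSpace μ}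
  (hX : X.IsBanachFunctionSpace) {s : ℝ} (hs : 0 < s) (hc : X.IsConcave s)

theorem control_eq_zero_iff {D : Set Ω} (hD : MeasurableSet[hX.deltaRing.loc] D) :
    (hX.vectorMeasure hs hc).control D = 0 ↔ ∀ C ∈ X.indicatorSets, C ⊆ D → μ C = 0 := by
  rw [DeltaRingMeasure.control_eq_zero_iff _ hD]
  exact forall₂_congr fun C hC => imp_congr_right fun _ => hX.indicatorElem_eq_zero_iff hC

theorem control_eq_zero (S : Set Ω) (h : μ S = 0) : (hX.vectorMeasure hs hc).control S = 0 := by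
  refine measure_mono_null (subset_toMeasurable μ S) ?_
  rw [hX.control_eq_zero_iff hs hc (hX.le_loc _ (measurableSet_toMeasurable μ S))]
  exact fun C _ hC => measure_mono_null hC (by rwa [measure_toMeasurable])

/-- The inclusion of the space into the space of classes modulo the vector measure. -/
def toControl : L0 μ → L0 (hX.vectorMeasure hs hc).control :=
  changeClass hX.le_loc μ (hX.vectorMeasure hs hc).control

theorem simpleIntegral_eq (x' : hX.Space →L[ℝ] ℝ) (ψ : RSimple hX.deltaRing) (A : Set Ω) :
    ((hX.vectorMeasure hs hc).dualComp x').simpleIntegral ψ A = x' (hX.simpleElem ψ A) := by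
  rw [simpleElem, map_sum]
  refine Finset.sum_congr rfl fun j _ => ?_
  rw [map_smul, smul_eq_mul]
  rfl

/-- One sequence of simple functions converging to e in X serves all x* at once: integrating over A
is restriction, so the integrals form a Cauchy sequence in X, with limit e when A is all of Ω. -/
theorem exists_hasIntegral (e : hX.Space) {A : Set Ω} (hA : MeasurableSet[hX.deltaRing.loc] A) :
    ∃ x, (hX.vectorMeasure hs hc).HasIntegral (hX.toControl hs hc (hX.incl e)) A x ∧
      (A = univ → x = e) := by
  obtain ⟨φ, v, hv, hlim⟩ := hX.exists_simpleFunc_tendsto hs hc e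
  choose ψ hψ using fun n => hX.exists_rSimple (hv n)
  have hcau : CauchySeq fun n => hX.simpleElem (ψ n) A := by
    rw [Metric.cauchySeq_iff]
    intro ε hε
    obtain ⟨N, hN⟩ := Metric.cauchySeq_iff.1 hlim.cauchySeq ε hε
    refine ⟨N, fun k hk n hn => lt_of_le_of_lt ?_ (hN k hk n hn)⟩
    rw [dist_eq_norm, dist_eq_norm]
    refine norm_le_of_ae ?_
    filter_upwards [hv k, hv n, hX.simpleElem_ae (ψ k) hA, hX.simpleElem_ae (ψ n) hA,
      hX.incl_sub (v k) (v n), hX.incl_sub (hX.simpleElem (ψ k) A) (hX.simpleElem (ψ n) A)]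
      with x h1 h2 h3 h4 h5 h6
    rw [h5, h6, h1, h2, h3, h4]
    by_cases hx : x ∈ A
    · simp [hx, hψ]
    · simp [hx]
  obtain ⟨x, hx⟩ := cauchySeq_tendsto_of_complete hcau
  refine ⟨x, fun x' => ⟨ψ, ?_, ?_⟩, ?_⟩
  · refine tendsto_of_tendsto_of_tendsto_of_le_of_le (h := fun n => ‖x'‖ₑ * ‖v n - e‖ₑ)
      tendsto_const_nhds ?_ (fun _ => zero_le) fun n => ?_
    · have h1 : Tendsto (fun n => ‖v n - e‖ₑ) atTop (𝓝 0) := by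
        have := (continuous_enorm.tendsto _).comp (hlim.sub_const e)
        simpa [Function.comp_def] using this
      simpa using ENNReal.Tendsto.const_mul (a := ‖x'‖ₑ) h1 (Or.inr enorm_ne_top)
    · have h1 : ∀ᵐ x ∂((hX.vectorMeasure hs hc).dualComp x').variation,
          ‖(ψ n).eval x - hX.toControl hs hc (hX.incl e) x‖ₑ = ‖(ψ n).eval x - hX.incl e x‖ₑ := by
        filter_upwards [DeltaRingMeasure.ae_variation_of_ae_control _ x'
          (changeClass_ae hX.le_loc (hX.incl e))] with x h
        rw [toControl, h]
      change ∫⁻ x, ‖(ψ n).eval x - hX.toControl hs hc (hX.incl e) x‖ₑ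
        ∂((hX.vectorMeasure hs hc).dualComp x').variation ≤ _
      rw [lintegral_congr_ae h1]
      refine hX.lintegral_variation_le x' hs hc ?_
      filter_upwards [hv n, hX.incl_sub (v n) e] with x h2 h3
      rw [h3, h2, hψ]
  · simp only [simpleIntegral_eq]
    exact (x'.continuous.tendsto x).comp hx
  · rintro rfl
    refine tendsto_nhds_unique hx (hlim.congr fun n => ext_ae ?_)
    filter_upwards [hv n, hX.simpleElem_univ_ae (ψ n)] with x h1 h2
    rw [h1, h2, hψ]

/-- The idea is to test on bounded pieces. On A = C ∩ {|g| ≤ k} the function g defines an element u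
of X, and functionals of the form x* ∘ (restriction to A) show that x restricted to A is u. -/
theorem ae_eq_of_hasRealIntegral {g : Ω → ℝ} (hg : Measurable[hX.deltaRing.loc] g) {x : hX.Space}
    (h : ∀ x' : hX.Space →L[ℝ] ℝ,
      ((hX.vectorMeasure hs hc).dualComp x').HasRealIntegral g univ (x' x))
    {C : Set Ω} (hC : C ∈ X.indicatorSets) : ∀ᵐ y ∂μ, y ∈ C → hX.incl x y = g y := by
  have key : ∀ k : ℕ, ∀ᵐ y ∂μ, y ∈ C → |g y| ≤ k → hX.incl x y = g y := by
    intro k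
    have hgm : MeasurableSet[hX.deltaRing.loc] {y | |g y| ≤ k} :=
      (measurable_norm.comp hg) (measurableSet_Iic (a := (k : ℝ)))
    set A := C ∩ {y | |g y| ≤ k} with hAdef
    have hA : A ∈ hX.deltaRing.sets := hX.inter_mem_of_loc hgm hC
    have hAm : MeasurableSet A := hX.measurableSet_of_mem hA
    have hgA : Measurable (A.indicator g) := by
      have := hX.measurable_indicator_of_loc hg (C := fun _ => A) fun _ => hA
      rwa [iUnion_const] at this
    obtain ⟨u, hu⟩ := exists_of_le_mul (hX := hX) hgA.aestronglyMeasurable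
      (hX.indicatorElem A) k (by
        filter_upwards [hX.indicatorElem_ae hA] with y hy
        rw [hy]
        by_cases hyA : y ∈ A
        · simpa [hyA] using hyA.2
        · simp [hyA])
    have hxu : hX.restrict hAm x = u := by
      rw [← sub_eq_zero]
      refine SeparatingDual.eq_zero_of_forall_dual_eq_zero (R := ℝ) fun x' => ?_
      rw [map_sub, sub_eq_zero]
      set y' : hX.Space →L[ℝ] ℝ := x'.comp (hX.restrict hAm) with hy'
      have hru : hX.restrict hAm u = u := ext_ae (by
        filter_upwards [hu, restrict_ae (hX := hX) hAm u] with y h1 h2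
        rw [h2]
        by_cases hyA : y ∈ A
        · rw [indicator_of_mem hyA]
        · rw [h1, indicator_of_notMem hyA, indicator_of_notMem hyA])
      have hyu : y' u = x' u := by rw [hy', ContinuousLinearMap.comp_apply, hru]
      rw [← hyu]
      obtain ⟨φ, hφ1, hφ2⟩ := h y'
      refine tendsto_nhds_unique hφ2 ?_
      simp only [simpleIntegral_eq]
      -- Since y* ignores everything off A, its variation measure is concentrated on A. So the
      -- simple functions approximating g in the hypothesis also approximate u, and their integrals
      -- tend both to y*(x) and to y*(u).
      have hnull : ∀ᵐ y ∂((hX.vectorMeasure hs hc).dualComp y').variation, y ∈ A := by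
        change ((hX.vectorMeasure hs hc).dualComp y').variation Aᶜ = 0
        rw [DeltaRingMeasure.variation_apply _ (hX.le_loc _ hAm.compl),
          DeltaRingMeasure.variationFun_eq_zero_iff]
        intro B hB hBA
        have h0 : hX.restrict hAm (hX.indicatorElem B) = 0 := ext_ae (by
          filter_upwards [hX.indicatorElem_ae hB, hX.incl_zero,
            restrict_ae (hX := hX) hAm (hX.indicatorElem B)] with y h1 h2 h3
          rw [h3, h2]
          by_cases hyA : y ∈ A
          · rw [indicator_of_mem hyA, h1, indicator_of_notMem fun hyB => hBA hyB hyA]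
          · rw [indicator_of_notMem hyA])
        change x' (hX.restrict hAm (hX.indicatorElem B)) = 0
        rw [h0, map_zero]
      rw [tendsto_iff_edist_tendsto_0]
      refine tendsto_of_tendsto_of_tendsto_of_le_of_le tendsto_const_nhds hφ1
        (fun _ => zero_le) fun n => ?_
      change edist (y' (hX.simpleElem (φ n) univ)) (y' u) ≤ _
      rw [edist_eq_enorm_sub, ← map_sub]
      refine (hX.enorm_le_lintegral_variation y' hs hc
        (f := fun y => (φ n).eval y - A.indicator g y)
        ((hX.measurable_eval (φ n)).sub hgA) ?_).trans (le_of_eq (lintegral_congr_ae ?_))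
      · filter_upwards [hu, hX.simpleElem_univ_ae (φ n),
          hX.incl_sub (hX.simpleElem (φ n) univ) u] with y h1 h2 h3
        rw [h3, h2, h1]
      · filter_upwards [hnull] with y hy
        simp [hy]
    filter_upwards [hu, restrict_ae (hX := hX) hAm x] with y h1 h2 hyC hyk
    have hyA : y ∈ A := ⟨hyC, hyk⟩
    rw [hxu, h1, indicator_of_mem hyA, indicator_of_mem hyA] at h2
    exact h2.symm
  filter_upwards [ae_all_iff.2 key] with y hy hyC
  obtain ⟨k, hk⟩ := exists_nat_ge |g y|
  exact hy k hyC hk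

/-- Surjectivity onto L¹(m): the preimage of g is its integral over Ω. Equality on every ring set is
enough, because m-null sets are tested on their ring subsets. -/
theorem toControl_eq_of_hasIntegral {g : L0 (hX.vectorMeasure hs hc).control} {x : hX.Space}
    (h : (hX.vectorMeasure hs hc).HasIntegral g univ x) :
    hX.toControl hs hc (hX.incl x) = g := by
  rw [toControl, changeClass_eq_iff]
  have hg : Measurable[hX.deltaRing.loc] g := L0.measurable g
  have hx : Measurable[hX.deltaRing.loc] (hX.incl x) :=
    (AEEqFun.measurable (hX.incl x)).mono hX.le_loc le_rfl
  change (hX.vectorMeasure hs hc).control {y | hX.incl x y = g y}ᶜ = 0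
  rw [hX.control_eq_zero_iff hs hc]
  · intro C hC hCD
    rw [measure_eq_zero_iff_ae_notMem]
    filter_upwards [hX.ae_eq_of_hasRealIntegral hs hc hg h hC] with y hy hyC
    exact hCD hyC (hy hyC)
  · exact (measurableSet_eq_fun hx hg).compl

/-- The set where a and b differ is m-null but not obviously μ-null; it is μ-null because a - b,
being in X, must vanish a.e. on it. -/
theorem toControl_injOn : InjOn (hX.toControl hs hc) X.carrier := by
  intro f hf g hg hfg
  obtain ⟨a, rfl⟩ := hX.exists_incl_eq hf
  obtain ⟨b, rfl⟩ := hX.exists_incl_eq hg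
  rw [toControl, changeClass_eq_iff] at hfg
  have hD : MeasurableSet {y | hX.incl a y = hX.incl b y}ᶜ :=
    (measurableSet_eq_fun (AEEqFun.measurable _) (AEEqFun.measurable _)).compl
  have h0 : (hX.vectorMeasure hs hc).control {y | hX.incl a y = hX.incl b y}ᶜ = 0 := by
    filter_upwards [hfg, changeClass_ae hX.le_loc (hX.incl b)] with y h1 h2
    rw [h1]; exact h2
  have h1 := hX.ae_eq_zero_of_forall_null hD
    ((hX.control_eq_zero_iff hs hc (hX.le_loc _ hD)).1 h0) (a - b)
  refine AEEqFun.ext ?_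
  filter_upwards [h1, hX.incl_sub a b] with y h2 h3
  by_contra hy
  rw [h3, sub_eq_zero] at h2
  exact hy (h2 hy)

theorem lintegral_toControl (e : hX.Space) (x' : hX.Space →L[ℝ] ℝ) :
    ∫⁻ x, ‖hX.toControl hs hc (hX.incl e) x‖ₑ ∂((hX.vectorMeasure hs hc).dualComp x').variation
      = ∫⁻ x, ‖hX.incl e x‖ₑ ∂((hX.vectorMeasure hs hc).dualComp x').variation := by
  refine lintegral_congr_ae ?_
  filter_upwards [DeltaRingMeasure.ae_variation_of_ae_control _ x'
    (changeClass_ae hX.le_loc (hX.incl e))] with x h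
  rw [toControl, h]

theorem toControl_mem (e : hX.Space) :
    hX.toControl hs hc (hX.incl e) ∈ (hX.vectorMeasure hs hc).L1.carrier := by
  refine ⟨fun x' => ⟨?_, ?_⟩, fun A hA => ?_⟩
  · exact (L0.stronglyMeasurable_rep (hX.toControl hs hc (hX.incl e))).aestronglyMeasurable
  · rw [HasFiniteIntegral, lintegral_toControl]
    exact (hX.lintegral_variation_le x' hs hc (Eventually.of_forall fun x => le_rfl)).trans_lt
      (ENNReal.mul_lt_top enorm_lt_top enorm_lt_top)
  · obtain ⟨x, hx, -⟩ := hX.exists_hasIntegral hs hc e hA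
    exact ⟨x, hx⟩

theorem exists_toControl_eq {g : L0 (hX.vectorMeasure hs hc).control}
    (hg : g ∈ (hX.vectorMeasure hs hc).L1.carrier) :
    ∃ e, hX.toControl hs hc (hX.incl e) = g := by
  obtain ⟨x, hx⟩ := hg.2 univ .univ
  exact ⟨x, hX.toControl_eq_of_hasIntegral hs hc hx⟩

/-- The two integral estimates sandwich the supremum, and a norming functional for e attains ‖e‖. -/
theorem qnorm_toControl (e : hX.Space) :
    (hX.vectorMeasure hs hc).L1.qnorm (hX.toControl hs hc (hX.incl e)) = ‖e‖ := by
  have h : (⨆ (x' : hX.Space →L[ℝ] ℝ) (_ : ‖x'‖ ≤ 1),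
      ∫⁻ x, ‖hX.toControl hs hc (hX.incl e) x‖ₑ
        ∂((hX.vectorMeasure hs hc).dualComp x').variation) = ‖e‖ₑ := by
    simp only [lintegral_toControl]
    refine le_antisymm (iSup₂_le fun x' hx' => ?_) ?_
    · refine (hX.lintegral_variation_le x' hs hc (Eventually.of_forall fun x => le_rfl)).trans ?_
      refine mul_le_of_le_one_left' ?_
      rw [← ofReal_norm]
      exact ENNReal.ofReal_le_one.2 hx'
    · obtain ⟨x', hx', hx'e⟩ := exists_dual_vector'' ℝ e
      refine le_trans ?_ (le_iSup₂ x' hx')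
      refine le_trans (le_of_eq ?_) (hX.enorm_le_lintegral_variation x' hs hc
        (AEEqFun.measurable (hX.incl e)) (Eventually.of_forall fun _ => rfl))
      rw [hx'e, RCLike.ofReal_real_eq_id, id, enorm_norm]
  change ENNReal.toReal _ = _
  rw [h, toReal_enorm]

/-- Whichever integral is chosen represents the same class modulo m, so injectivity forces it to be
e. -/
theorem integrationOperator_toControl (e : hX.Space) :
    (hX.vectorMeasure hs hc).integrationOperator (hX.toControl hs hc (hX.incl e)) = e := by
  obtain ⟨x, hx, -⟩ := hX.exists_hasIntegral hs hc e (A := univ) .univ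
  have h : ∃ x, (hX.vectorMeasure hs hc).HasIntegral (hX.toControl hs hc (hX.incl e)) univ x :=
    ⟨x, hx⟩
  rw [DeltaRingMeasure.integrationOperator, dif_pos h]
  exact hX.incl_injective (hX.toControl_injOn hs hc (hX.incl_mem _) (hX.incl_mem _)
    (hX.toControl_eq_of_hasIntegral hs hc h.choose_spec))

/-- A concave Banach function space coincides with the space `L¹` of the vector measure
`A ↦ χ_A`. -/
theorem coincideWith_L1 : CoincideWith X (hX.vectorMeasure hs hc).L1 1 1 := by
  refine ⟨hX.le_loc, hX.control_eq_zero hs hc, ⟨?_, hX.toControl_injOn hs hc, ?_⟩, ?_⟩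
  · intro f hf
    obtain ⟨e, rfl⟩ := hX.exists_incl_eq hf
    exact hX.toControl_mem hs hc e
  · intro g hg
    obtain ⟨e, he⟩ := hX.exists_toControl_eq hs hc hg
    exact ⟨_, hX.incl_mem e, he⟩
  · intro f hf
    obtain ⟨e, rfl⟩ := hX.exists_incl_eq hf
    have := hX.qnorm_toControl hs hc e
    rw [toControl] at this
    rw [this, one_mul, hX.norm_eq]
    exact ⟨le_rfl, le_rfl⟩

theorem isConcaveOperator_integrationOperator :
    (hX.vectorMeasure hs hc).L1.IsConcaveOperator (fun x : hX.Space => ‖x‖)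
      (hX.vectorMeasure hs hc).integrationOperator s := by
  refine ⟨fun f hf g hg => ?_, fun c f hf => ?_, ?_⟩
  · obtain ⟨a, rfl⟩ := hX.exists_toControl_eq hs hc hf
    obtain ⟨b, rfl⟩ := hX.exists_toControl_eq hs hc hg
    have : hX.toControl hs hc (hX.incl a) + hX.toControl hs hc (hX.incl b)
        = hX.toControl hs hc (hX.incl (a + b)) := by
      rw [map_add, toControl, changeClass_add _ (hX.control_eq_zero hs hc)]
    rw [this]
    simp only [integrationOperator_toControl]
  · obtain ⟨a, rfl⟩ := hX.exists_toControl_eq hs hc hf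
    have : c • hX.toControl hs hc (hX.incl a) = hX.toControl hs hc (hX.incl (c • a)) := by
      rw [map_smul, toControl, changeClass_smul _ (hX.control_eq_zero hs hc)]
    rw [this]
    simp only [integrationOperator_toControl]
  · obtain ⟨C, hC, h⟩ := hc.2.2
    refine ⟨C, hC, fun n f hf => ?_⟩
    choose a ha using fun j => hX.exists_toControl_eq hs hc (hf j)
    obtain ⟨b, hb⟩ := hX.exists_incl_eq (hX.lqSum_mem hs fun j => hX.incl_mem (a j))
    have h1 : lqSum s f = hX.toControl hs hc (hX.incl b) := by
      rw [hb, toControl, changeClass_lqSum _ (hX.control_eq_zero hs hc)]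
      congr 1
      funext j
      exact (ha j).symm
    rw [h1, qnorm_toControl]
    simp only [← ha, integrationOperator_toControl]
    have h2 := h n (fun j => hX.incl (a j)) fun j => hX.incl_mem _
    rwa [← hb] at h2

end FnSpace.IsBanachFunctionSpace

/-! ### From L¹(m) = Z^(1/p) to L^p(m) = Z -/

namespace FnSpace

variable {Ω : Type*} {mΩ : MeasurableSpace Ω} {μ : Measure Ω} {Y Z : FnSpace μ}

theorem hasIndicator_power_iff {p : ℝ} (hp : 0 < p)
    (hcar : Y.carrier = (Z.power (1 / p)).carrier) (A : Set Ω) :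
    Y.HasIndicator A ↔ Z.HasIndicator A := by
  have hp' : 1 / p ≠ 0 := by positivity
  constructor
  · rintro ⟨f, hf, h⟩
    rw [hcar] at hf
    refine ⟨_, hf, ?_⟩
    filter_upwards [h, absPow_ae (1 / p) f] with x h1 h2
    rw [h2, h1]
    by_cases hx : x ∈ A <;> simp [hx, hp.ne']
  · rintro ⟨f, hf, h⟩
    refine ⟨f, ?_, h⟩
    rw [hcar]
    have : absPow (1 / p) f = f := by
      refine AEEqFun.ext ?_
      filter_upwards [h, absPow_ae (1 / p) f] with x h1 h2
      rw [h2, h1]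
      by_cases hx : x ∈ A <;> simp [hx, hp.ne']
    change absPow (1 / p) f ∈ Z.carrier
    rwa [this]

theorem absPow_mem_power_iff {p : ℝ} (hp : 0 < p) (hZ : Z.IsBanachFunctionSpace) {f : L0 μ} :
    absPow p f ∈ (Z.power (1 / p)).carrier ↔ f ∈ Z.carrier := by
  have hx : ∀ᵐ x ∂μ, absPow (1 / p) (absPow p f) x = |f x| := by
    filter_upwards [absPow_ae (1 / p) (absPow p f), absPow_ae p f] with x h1 h2
    rw [h1, h2, abs_of_nonneg (Real.rpow_nonneg (abs_nonneg _) _), ← Real.rpow_mul (abs_nonneg _),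
      mul_one_div_cancel hp.ne', Real.rpow_one]
  constructor
  · intro h
    refine (hZ.ideal _ h f ?_).1
    filter_upwards [hx] with x h1
    rw [h1, abs_abs]
  · intro h
    refine (hZ.ideal _ h _ ?_).1
    filter_upwards [hx] with x h1
    rw [h1, abs_abs]

theorem power_qnorm_absPow {p : ℝ} (hp : 0 < p) (hZ : Z.IsBanachFunctionSpace) {f : L0 μ}
    (hf : f ∈ Z.carrier) : (Z.power (1 / p)).qnorm (absPow p f) ^ (1 / p) = Z.qnorm f := by
  have hf' := (absPow_mem_power_iff hp hZ).2 hf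
  rw [power_qnorm_rpow hZ (by positivity) hf']
  have hx : ∀ᵐ x ∂μ, |absPow (1 / p) (absPow p f) x| = |f x| := by
    filter_upwards [absPow_ae (1 / p) (absPow p f), absPow_ae p f] with x h1 h2
    rw [h1, h2, abs_of_nonneg (a := |f x| ^ p) (by positivity), ← Real.rpow_mul (abs_nonneg _),
      mul_one_div_cancel hp.ne', Real.rpow_one, abs_abs]
  refine le_antisymm (hZ.ideal _ hf _ ?_).2 (hZ.ideal _ hf' _ ?_).2
  · filter_upwards [hx] with x h using h.le
  · filter_upwards [hx] with x h using h.ge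

/-- If `Y` is a Banach function space which is equal to `Z^(1/p)` up to equivalence of norms, then
`Z` coincides with `L^p` of the vector measure `A ↦ χ_A` in `Y`. -/
theorem coincideWith_Lp {p s c C : ℝ} (hp : 0 < p) (hZ : Z.IsBanachFunctionSpace)
    (hY : Y.IsBanachFunctionSpace) (hs : 0 < s) (hconc : Y.IsConcave s)
    (hcar : Y.carrier = (Z.power (1 / p)).carrier) (hc : 0 ≤ c) (hC : 0 ≤ C)
    (hle : ∀ f ∈ Y.carrier, c * (Z.power (1 / p)).qnorm f ≤ Y.qnorm f ∧
      Y.qnorm f ≤ C * (Z.power (1 / p)).qnorm f) :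
    CoincideWith Z ((hY.vectorMeasure hs hconc).Lp p) (c ^ (1 / p)) (C ^ (1 / p)) := by
  obtain ⟨_, h0, ⟨hmaps, -, hsurj⟩, hnorm⟩ := hY.coincideWith_L1 hs hconc
  have hmem : ∀ f : L0 μ, f ∈ Z.carrier ↔ absPow p f ∈ Y.carrier := fun f => by
    rw [hcar, absPow_mem_power_iff hp hZ]
  have hsets : ∀ C ∈ Y.indicatorSets, C ∈ Z.indicatorSets := fun C hC =>
    ⟨hC.1, (hasIndicator_power_iff hp hcar C).1 hC.2⟩
  have hsets' : ∀ C ∈ Z.indicatorSets, C ∈ Y.indicatorSets := fun C hC =>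
    ⟨hC.1, (hasIndicator_power_iff hp hcar C).2 hC.2⟩
  refine ⟨hY.le_loc, h0, ⟨fun f hf => ?_, fun f hf g hg hfg => ?_, fun g hg => ?_⟩, fun f hf => ?_⟩
  · change absPow p (changeClass _ _ _ f) ∈ (hY.vectorMeasure hs hconc).L1.carrier
    rw [← changeClass_absPow _ h0]
    exact hmaps ((hmem f).1 hf)
  · obtain ⟨a, rfl⟩ := hZ.exists_incl_eq hf
    obtain ⟨b, rfl⟩ := hZ.exists_incl_eq hg
    rw [changeClass_eq_iff] at hfg
    have hD : MeasurableSet {y | hZ.incl a y = hZ.incl b y}ᶜ :=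
      (measurableSet_eq_fun (AEEqFun.measurable _) (AEEqFun.measurable _)).compl
    have hD0 : (hY.vectorMeasure hs hconc).control {y | hZ.incl a y = hZ.incl b y}ᶜ = 0 := by
      filter_upwards [hfg, changeClass_ae hY.le_loc (hZ.incl b)] with y h1 h2
      rw [h1]; exact h2
    have h1 := hZ.ae_eq_zero_of_forall_null hD (fun C hC hCD =>
      (hY.control_eq_zero_iff hs hconc (hY.le_loc _ hD)).1 hD0 C (hsets' C hC) hCD) (a - b)
    refine AEEqFun.ext ?_
    filter_upwards [h1, hZ.incl_sub a b] with y h2 h3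
    by_contra hy
    rw [h3, sub_eq_zero] at h2
    exact hy (h2 hy)
  · obtain ⟨k, hk, hkg⟩ := hsurj (show absPow p g ∈ _ from hg)
    obtain ⟨e, rfl⟩ := hY.exists_incl_eq hk
    rw [changeClass_eq_iff] at hkg
    have hem : Measurable (hY.incl e) := AEEqFun.measurable _
    -- These ring sets exhaust the support of e, the representative of |g|^p in Y. Cutting g down to
    -- their union makes it Σ-measurable and changes it only on an m-null set.
    let S : ℕ → Set Ω := fun n => {x | 1 ≤ (n : ℝ) * |hY.incl e x|}
    have hS : ∀ n, S n ∈ hY.deltaRing.sets := fun n => hY.mem_indicatorSets_of_le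
      (measurableSet_le measurable_const (measurable_const.mul hem.abs)) e n
      (Eventually.of_forall fun _ hx => hx)
    have hT : ∀ x, x ∈ ⋃ n, S n ↔ hY.incl e x ≠ 0 := by
      intro x
      rw [mem_iUnion]
      constructor
      · rintro ⟨n, hn⟩ h
        have hn' : 1 ≤ (n : ℝ) * |hY.incl e x| := hn
        rw [h, abs_zero, mul_zero] at hn'
        linarith
      · intro h
        obtain ⟨n, hn⟩ := exists_nat_ge (|hY.incl e x|⁻¹)
        exact ⟨n, (inv_le_iff_one_le_mul₀ (abs_pos.2 h)).1 hn⟩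
    have hgm : Measurable ((⋃ n, S n).indicator g) :=
      hY.measurable_indicator_of_loc (L0.measurable g) hS
    let f : L0 μ := AEEqFun.mk _ hgm.aestronglyMeasurable
    have hf : ∀ᵐ x ∂μ, f x = (⋃ n, S n).indicator g x := AEEqFun.coeFn_mk _ _
    have hD : MeasurableSet {x | hY.incl e x = |(⋃ n, S n).indicator g x| ^ p}ᶜ :=
      (measurableSet_eq_fun hem (hgm.abs.pow_const p)).compl
    have hD0 : (hY.vectorMeasure hs hconc).control
        {x | hY.incl e x = |(⋃ n, S n).indicator g x| ^ p}ᶜ = 0 := by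
      filter_upwards [hkg, absPow_ae p g] with x h1 h2
      by_cases hx : x ∈ ⋃ n, S n
      · rw [indicator_of_mem hx, h1, h2]
      · rw [indicator_of_notMem hx, abs_zero, Real.zero_rpow hp.ne']
        exact not_not.1 fun h => hx ((hT x).2 h)
    -- The equality holds m-a.e.; on the exceptional set e vanishes μ-a.e., and wherever e = 0 the
    -- right side is 0 too. So it holds μ-a.e.
    have hek : ∀ᵐ x ∂μ, hY.incl e x = |(⋃ n, S n).indicator g x| ^ p := by
      filter_upwards [hY.ae_eq_zero_of_forall_null hD
        ((hY.control_eq_zero_iff hs hconc (hY.le_loc _ hD)).1 hD0) e] with x hx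
      by_contra hne
      have hx0 := hx hne
      have hxT : x ∉ ⋃ n, S n := fun h => (hT x).1 h hx0
      rw [hx0, indicator_of_notMem hxT, abs_zero, Real.zero_rpow hp.ne'] at hne
      exact hne rfl
    refine ⟨f, (hmem f).2 ?_, ?_⟩
    · have : absPow p f = hY.incl e := by
        refine AEEqFun.ext ?_
        filter_upwards [absPow_ae p f, hf, hek] with x h1 h2 h3
        rw [h1, h2, h3]
      rw [this]
      exact hk
    · rw [changeClass_eq_iff]
      filter_upwards [ae_of_ae_of_null h0 hf, hkg, absPow_ae p g] with x h1 h2 h3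
      rw [h1]
      by_cases hx : x ∈ ⋃ n, S n
      · rw [indicator_of_mem hx]
      · rw [indicator_of_notMem hx]
        have h4 : hY.incl e x = 0 := not_not.1 fun h => hx ((hT x).2 h)
        rw [h2, h3, Real.rpow_eq_zero (abs_nonneg _) hp.ne', abs_eq_zero] at h4
        exact h4.symm
  · have hf' := (hmem f).1 hf
    have hfp := (absPow_mem_power_iff hp hZ).2 hf
    have hr : 0 ≤ 1 / p := by positivity
    have hN := power_qnorm_nonneg hZ hfp
    have hn := hnorm _ hf'
    rw [one_mul] at hn
    have h1 : ((hY.vectorMeasure hs hconc).Lp p).qnorm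
        (changeClass hY.le_loc μ (hY.vectorMeasure hs hconc).control f)
        = Y.qnorm (absPow p f) ^ (1 / p) := by
      rw [← le_antisymm hn.2 hn.1, changeClass_absPow _ h0]
      rfl
    rw [h1, ← power_qnorm_absPow hp hZ hf, ← Real.mul_rpow hc hN, ← Real.mul_rpow hC hN]
    exact ⟨Real.rpow_le_rpow (by positivity) (hle _ hf').1 hr,
      Real.rpow_le_rpow (hY.norm_nonneg _ hf') (hle _ hf').2 hr⟩

end FnSpace

end

/-! ### The proposition -/

theorem mainTheorem5 {Ω : Type u} {mΩ : MeasurableSpace Ω} (ξ : Measure Ω) (p q : ℝ)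
    (hp : 0 < p) (hq : 0 < q) (Z : FnSpace ξ) (hZ : Z.IsBanachFunctionSpace)
    (hconc : Z.IsConcave q) (hconv : 1 < p → Z.IsConvex p) :
    -- `Y` is `Z^(1/p)`, renormed (if necessary) to be a Banach function space
    ∃ Y : FnSpace ξ, Y.IsBanachFunctionSpace ∧
      Y.carrier = (Z.power (1 / p)).carrier ∧
      (∃ c > 0, ∃ C > 0, ∀ f ∈ Y.carrier,
        c * (Z.power (1 / p)).qnorm f ≤ Y.qnorm f ∧ Y.qnorm f ≤ C * (Z.power (1 / p)).qnorm f) ∧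
      (p ≤ 1 ∨ Z.IsConvexWith p 1 → ∀ f ∈ Y.carrier, Y.qnorm f = (Z.power (1 / p)).qnorm f) ∧
      -- `E` is `Y` as a Banach space, `J` being the inclusion into the measurable functions
      ∃ (E : Type u) (_ : NormedAddCommGroup E) (_ : NormedSpace ℝ E) (_ : CompleteSpace E)
        (J : E →ₗ[ℝ] L0 ξ),
        Function.Injective J ∧ range J = Y.carrier ∧ (∀ x, ‖x‖ = Y.qnorm (J x)) ∧
        -- `m(A) = χ_A` is a vector measure on the `δ`-ring `Σ_Z`
        ∃ (R : DeltaRing Ω) (m : DeltaRingMeasure R E),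
          R.sets = Z.indicatorSets ∧
          (∀ A ∈ R.sets, J (m.toFun A) =ᵐ[ξ] A.indicator (fun _ => (1 : ℝ))) ∧
          -- `Z = L^p(m)`
          (∃ c > 0, ∃ C > 0, CoincideWith Z (m.Lp p) c C) ∧
          (p ≤ 1 ∨ Z.IsConvexWith p 1 → CoincideWith Z (m.Lp p) 1 1) ∧
          m.L1.IsConcaveOperator (fun x : E => ‖x‖) m.integrationOperator (q / p) ∧
          -- if `χ_Ω ∈ Z`, the domain of `m` is the σ-algebra of all measurable sets
          (Z.HasIndicator univ → R.sets = {A | MeasurableSet A}) := by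
  obtain ⟨D, hD, hsum, hD1⟩ := FnSpace.exists_hasSumEstimate hZ hp hconv
  have hr : 0 < 1 / p := by positivity
  have hs : 0 < q / p := by positivity
  have h0 : ∀ f ∈ (Z.power (1 / p)).carrier, 0 ≤ (Z.power (1 / p)).qnorm f :=
    fun f hf => FnSpace.power_qnorm_nonneg hZ hf
  have hY := FnSpace.power_renorm_isBanachFunctionSpace hZ hr hD hsum
  have hYc := FnSpace.power_renorm_isConcave hZ hp hq hD hsum hconc
  have hle : ∀ f ∈ (Z.power (1 / p)).renorm.carrier,
      D⁻¹ * (Z.power (1 / p)).qnorm f ≤ (Z.power (1 / p)).renorm.qnorm f ∧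
        (Z.power (1 / p)).renorm.qnorm f ≤ 1 * (Z.power (1 / p)).qnorm f := fun f hf => by
    rw [inv_mul_le_iff₀ hD, one_mul]
    exact ⟨FnSpace.qnorm_le_mul_renorm_qnorm hD hsum hf, FnSpace.renorm_qnorm_le h0 hf⟩
  -- The constants are D⁻¹ and 1 for the norm, and their 1/p-th powers for L^p(m); all of them
  -- become 1 when D = 1.
  have hcoin := FnSpace.coincideWith_Lp hp hZ hY hs hYc rfl (inv_nonneg.2 hD.le) zero_le_one hle
  refine ⟨(Z.power (1 / p)).renorm, hY, rfl, ⟨D⁻¹, inv_pos.2 hD, 1, one_pos, hle⟩,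
    fun h f hf => ?_, hY.Space, inferInstance, inferInstance, inferInstance, hY.incl,
    hY.incl_injective, hY.range_incl, hY.norm_eq, hY.deltaRing, hY.vectorMeasure hs hYc,
    ?_, fun A hA => hY.indicatorElem_ae hA, ⟨_, by positivity, _, by positivity, hcoin⟩,
    fun h => ?_, hY.isConcaveOperator_integrationOperator hs hYc, fun h => ?_⟩
  · have := hle f hf
    rw [hD1 h, inv_one, one_mul] at this
    exact le_antisymm this.2 this.1
  · ext A
    exact and_congr_right fun _ => FnSpace.hasIndicator_power_iff hp rfl A
  · simpa [hD1 h] using hcoin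
  · ext A
    refine ⟨fun hA => hA.1, fun hA => hY.mem_indicatorSets_of_subset hA
      ⟨.univ, (FnSpace.hasIndicator_power_iff hp rfl univ).2 h⟩ (subset_univ A)⟩
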